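/- Let $X$ be a metrizable, locally compact, separable topological space and let $T\colon X\to X$ be any continuous map (not necessarily proper). All entropies below take values in $[0,\infty]$. Definitions. A cover of a set $Y$ is a family of sets whose union is $Y$. For a family $\mathcal A$ of subsets of $X$ and $Y\subset X$, $N_Y(\mathcal A)\in\{0,1,2,\dots,\infty\}$ is the least cardinality of a subfamily of $\{A\cap Y: A\in\mathcal A\}$ that covers $Y$; $N=N_X$; we put $\log\infty=\infty$ and (which matters only for $Y=\emptyset$) $\log 0=0$. For a family $\mathcal A$, $\mathcal A^n$ is the family of all nonempty sets $A_0\cap T^{-1}A_1\cap\dots\cap T^{-(n-1)}A_{n-1}$ with $A_j\in\mathcal A$. * Kolmogorov–Sinai entropy: for a $T$-invariant Borel probability measure $\mu$, $h_\mu(T)=\sup_{\mathcal C}\lim_n \frac1n\sum_{C\in\mathcal C^n}\mu(C)\log\frac1{\mu(C)}$, the supremum being over the finite measurable partitions $\mathcal C$ of $X$. * Topological entropy: $h(T)=\sup_{\mathcal A}\lim_n\frac1n\log N(\mathcal A^n)$, the supremum being over the admissible covers, i.e. the open covers $\mathcal A$ of $X$ at least one of whose members has compact complement. * For a metric $d$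 on $X$ compatible with the topology, let $d_n(x,y)=\max_{0\le j<n}d(T^jx,T^jy)$ and let $\mathcal B_{d_n}(\varepsilon)$ be the family of all open $d_n$-balls of radius $\varepsilon$ centred at points of $X$. The Bowen entropy is $h_d(T)=\sup_{\varepsilon>0,\ K\subset X\text{ compact}}\limsup_n\frac1n\log N_K(\mathcal B_{d_n}(\varepsilon))$, and the $d$-entropy is $h^d(T)=\sup_{\varepsilon>0}\limsup_n\frac1n\log N(\mathcal B_{d_n}(\varepsilon))$. Theorem. One has $$\sup_\mu h_\mu(T)=h(T)=\min_d h_d(T)=\min_d h^d(T),$$ where $\mu$ runs over the $T$-invariant Radon probability measures on $X$ (the supremum being $0$ if there are none) and $d$ runs over the metrics compatible with the topology of $X$; both minima are attained. Moreover, there are compatible metrics on $X$ that extend to a compatible metric of the one-point compactification $X\cup\{\infty\}$ of $X$, and every such metric $d$ satisfies $h_d(T)=h^d(T)=h(T)$. -/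

import Mathlib

open Set Filter Topology MeasureTheory
open scoped ENNReal

noncomputable section

namespace VarPrinciple

variable {X : Type*}

/-! ### Covers -/

/-- `𝒜` is a cover of the set `Y` by subsets of `Y`: the union of its members is `Y`. -/
def IsCoverOf (Y : Set X) (𝒜 : Set (Set X)) : Prop := ⋃₀ 𝒜 = Y

/-- The trace `Y ∩ 𝒜 = {Y ∩ A | A ∈ 𝒜}` of a family of sets on `Y`. -/
def traceCover (Y : Set X) (𝒜 : Set (Set X)) : Set (Set X) := (fun A => Y ∩ A) '' 𝒜

/-- `N_Y(𝒜)`: the least cardinality of a subfamily of `Y ∩ 𝒜` that covers `Y`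
(`⊤` when no finite subfamily does). -/
def coverNumber (Y : Set X) (𝒜 : Set (Set X)) : ℕ∞ :=
  ⨅ ℬ : Set (Set X), ⨅ _ : ℬ ⊆ traceCover Y 𝒜, ⨅ _ : IsCoverOf Y ℬ, ℬ.encard

/-- `log N_Y(𝒜)` in `[0, ∞]`, with `log ∞ = ∞`. For nonempty `Y` one has `N_Y(𝒜) ≥ 1`, so that the
truncation at zero plays no role; for `Y = ∅` the value is `0`. -/
def coverEntropy (Y : Set X) (𝒜 : Set (Set X)) : ℝ≥0∞ :=
  (ENNReal.log (coverNumber Y 𝒜 : ℝ≥0∞)).toENNReal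

/-- `𝒜 ∨ ℬ`: the nonempty intersections of a member of `𝒜` with a member of `ℬ`. -/
def joinCover (𝒜 ℬ : Set (Set X)) : Set (Set X) :=
  {S | S.Nonempty ∧ ∃ A ∈ 𝒜, ∃ B ∈ ℬ, S = A ∩ B}

/-- `𝒜ⁿ = 𝒜 ∨ T⁻¹𝒜 ∨ ⋯ ∨ T⁻⁽ⁿ⁻¹⁾𝒜` (the trivial cover for `n = 0`). -/
def iterCover (T : X → X) (𝒜 : Set (Set X)) : ℕ → Set (Set X)
  | 0 => {univ}
  | n + 1 => joinCover (iterCover T 𝒜 n) ((fun A => T^[n] ⁻¹' A) '' 𝒜)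

/-! ### Topological entropy through admissible covers -/

/-- An open cover is admissible when at least one of its members has compact complement. -/
structure IsAdmissible [TopologicalSpace X] (𝒜 : Set (Set X)) : Prop where
  isOpen : ∀ A ∈ 𝒜, IsOpen A
  isCover : IsCoverOf univ 𝒜
  exists_isCompact_compl : ∃ A ∈ 𝒜, IsCompact Aᶜ

/-- The entropy of `T` with respect to the cover `𝒜`, the limit of `(1/n) log N(𝒜ⁿ)`. The limit
exists by subadditivity, so it is the upper limit. -/
def entropyOfCover (T : X → X) (𝒜 : Set (Set X)) : ℝ≥0∞ :=
  limsup (fun n : ℕ => coverEntropy univ (iterCover T 𝒜 n) / (n : ℝ≥0∞)) atTop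

/-- The topological entropy of `T`: the supremum over the admissible covers. -/
def topologicalEntropy [TopologicalSpace X] (T : X → X) : ℝ≥0∞ :=
  ⨆ 𝒜 : Set (Set X), ⨆ _ : IsAdmissible 𝒜, entropyOfCover T 𝒜

/-! ### Kolmogorov–Sinai entropy -/

/-- Finite measurable partitions (an empty member is allowed and changes no entropy). -/
structure IsFinitePartition [MeasurableSpace X] (𝒞 : Set (Set X)) : Prop where
  finite : 𝒞.Finite
  measurableSet : ∀ C ∈ 𝒞, MeasurableSet C
  isCover : IsCoverOf univ 𝒞
  disjoint : ∀ C ∈ 𝒞, ∀ D ∈ 𝒞, C ≠ D → Disjoint C D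

/-- `H_μ(𝒞) = ∑_{C ∈ 𝒞} μ(C) log (1/μ(C))` for a probability measure `μ`; all terms are
nonnegative, and `0 log (1/0) = 0`. -/
def partitionEntropy [MeasurableSpace X] (μ : ProbabilityMeasure X) (𝒞 : Set (Set X)) : ℝ≥0∞ :=
  ∑' C : 𝒞, ENNReal.ofReal (Real.negMulLog (μ (C : Set X) : ℝ))

/-- `h_μ(𝒞, T)`, the limit of `(1/n) H_μ(𝒞ⁿ)`. For `T`-invariant `μ` the limit exists by
subadditivity, so it is the upper limit. -/
def entropyOfPartition [MeasurableSpace X] (T : X → X) (μ : ProbabilityMeasure X)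
    (𝒞 : Set (Set X)) : ℝ≥0∞ :=
  limsup (fun n : ℕ => partitionEntropy μ (iterCover T 𝒞 n) / (n : ℝ≥0∞)) atTop

/-- The Kolmogorov–Sinai entropy `h_μ(T)`. -/
def kolmogorovSinaiEntropy [MeasurableSpace X] (T : X → X) (μ : ProbabilityMeasure X) : ℝ≥0∞ :=
  ⨆ 𝒞 : Set (Set X), ⨆ _ : IsFinitePartition 𝒞, entropyOfPartition T μ 𝒞

/-- The supremum of `h_μ(T)` over the `T`-invariant Radon probability measures; it is `0` when there
is no such measure. -/
def supKolmogorovSinaiEntropy [TopologicalSpace X] [MeasurableSpace X] (T : X → X) : ℝ≥0∞ :=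
  ⨆ μ : ProbabilityMeasure X, ⨆ _ : (μ : Measure X).Regular,
    ⨆ _ : MeasurePreserving T (μ : Measure X) (μ : Measure X), kolmogorovSinaiEntropy T μ

/-! ### Entropies of a metric -/

/-- `d` is a metric on `X` that induces the given topology. -/
structure IsCompatibleMetric [TopologicalSpace X] (d : X → X → ℝ) : Prop where
  dist_self : ∀ x, d x x = 0
  eq_of_dist_eq_zero : ∀ x y, d x y = 0 → x = y
  dist_comm : ∀ x y, d x y = d y x
  dist_triangle : ∀ x y z, d x z ≤ d x y + d y z
  isOpen_iff : ∀ s : Set X, IsOpen s ↔ ∀ x ∈ s, ∃ ε > 0, {y | d x y < ε} ⊆ s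

/-- `d` is the restriction to `X` of a compatible metric of the one-point compactification. -/
def ExtendsToOnePoint [TopologicalSpace X] (d : X → X → ℝ) : Prop :=
  ∃ D : OnePoint X → OnePoint X → ℝ, IsCompatibleMetric D ∧
    ∀ x y : X, D (x : OnePoint X) (y : OnePoint X) = d x y

/-- `dₙ(x, y) = max_{0 ≤ j < n} d(Tʲx, Tʲy)`. -/
def iterDist (T : X → X) (d : X → X → ℝ) (n : ℕ) (x y : X) : ℝ :=
  ⨆ j : Fin n, d (T^[(j : ℕ)] x) (T^[(j : ℕ)] y)

/-- The family of all open balls of radius `ε` with respect to `d`. -/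
def balls (d : X → X → ℝ) (ε : ℝ) : Set (Set X) := range fun x => {y | d x y < ε}

/-- The `d`-entropy of `T`, with balls of the metrics `dₙ` covering the whole space. -/
def dEntropy (d : X → X → ℝ) (T : X → X) : ℝ≥0∞ :=
  ⨆ ε : ℝ, ⨆ _ : 0 < ε,
    limsup (fun n : ℕ => coverEntropy univ (balls (iterDist T d n) ε) / (n : ℝ≥0∞)) atTop

/-- The Bowen entropy of `T`, with balls of the metrics `dₙ` covering compact subsets. -/
def bowenEntropy [TopologicalSpace X] (d : X → X → ℝ) (T : X → X) : ℝ≥0∞ :=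
  ⨆ ε : ℝ, ⨆ _ : 0 < ε, ⨆ K : Set X, ⨆ _ : IsCompact K,
    limsup (fun n : ℕ => coverEntropy K (balls (iterDist T d n) ε) / (n : ℝ≥0∞)) atTop

end VarPrinciple

end

/-! # The variational principle for locally compact systems -/

namespace VarPrinciple

/-! ### Shannon entropy of finitely valued functions -/

section Shannon

open Real

/-! For every compatible `d` the chain h(T) ≤ sup h_μ(T) ≤ h_d(T) ≤ h^d(T) holds, and h^d(T) ≤ h(T)
when `d` extends to the one-point compactification. Such metrics exist because the compactification
is metrizable; one of them turns the chain into equalities, and minimality over all `d` follows from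
the chain itself.

sup h_μ ≤ h_d (`entropyOfPartition_le_bowenEntropy`): by regularity, a finite partition is
approximated by disjoint compact subsets of its atoms, at conditional entropy at most 1. These
compact sets are at positive distance, so a small `d_n`-ball meets only one word of codes once the
times of undefined code are prescribed, and these times can be chosen in 2^n ways. Restricting to a
compact set of nearly full measure adds another linear error. The total error 3n + 2 becomes
negligible when the estimate is applied to high powers of `T`.

h ≤ sup h_μ (`topologicalEntropy_le_supKolmogorovSinaiEntropy`): `T` need not extend continuously to
Y = X ∪ {∞}, so orbits are placed in Y^ℕ, where the shift is continuous. Empirical measures of large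
separated sets of orbits have a shift-invariant limit ν of large entropy (`exists_invariant_limit`).
Leaving the graph of `T` from a point of X is an open condition that no orbit satisfies, so ν is
carried by orbits of `T` and by the constant sequence ∞ (`ae_eq_orbitSeq`). The latter has a single
itinerary and carries only bounded entropy; hence orbits have positive mass, and the normalized
marginal of that part is the required measure (`exists_invariant_of_shift_invariant`).

h^d ≤ h (`dEntropy_le_topologicalEntropy`): for an extending metric, the open sets with all mutual
distances below ε form an admissible cover. -/

theorem negMulLog_add_le {a b : ℝ} (ha : 0 ≤ a) (hb : 0 ≤ b) :
    negMulLog (a + b) ≤ negMulLog a + negMulLog b := by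
  rcases ha.eq_or_lt with rfl | ha
  · simp
  rcases hb.eq_or_lt with rfl | hb
  · simp
  have h1 := mul_le_mul_of_nonneg_left (log_le_log ha (by linarith : a ≤ a + b)) ha.le
  have h2 := mul_le_mul_of_nonneg_left (log_le_log hb (by linarith : b ≤ a + b)) hb.le
  simp only [negMulLog]
  nlinarith

theorem negMulLog_sum_le {ι : Type*} (s : Finset ι) (p : ι → ℝ) (hp : ∀ i ∈ s, 0 ≤ p i) :
    negMulLog (∑ i ∈ s, p i) ≤ ∑ i ∈ s, negMulLog (p i) := by
  classical
  induction s using Finset.induction_on with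
  | empty => simp
  | insert a s ha ih =>
    rw [Finset.sum_insert ha, Finset.sum_insert ha]
    have hs : ∀ i ∈ s, 0 ≤ p i := fun i hi => hp i (Finset.mem_insert_of_mem hi)
    have := negMulLog_add_le (hp a (Finset.mem_insert_self a s)) (Finset.sum_nonneg hs)
    linarith [ih hs]

/-- The tangent inequality log t ≤ t - 1 at t = r / p. The last hypothesis excludes r = 0 < p, where
the convention `log 0 = 0` would spoil it. -/
theorem mul_log_div_le {p r : ℝ} (hp : 0 ≤ p) (hr : 0 ≤ r) (h : 0 < p → 0 < r) :
    p * log r - p * log p ≤ r - p := by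
  rcases hp.eq_or_lt with rfl | hp
  · simpa using hr
  have hr' := h hp
  have := mul_le_mul_of_nonneg_left (log_le_sub_one_of_pos (div_pos hr' hp)) hp.le
  rw [log_div hr'.ne' hp.ne', mul_sub, mul_sub, mul_div_cancel₀ _ hp.ne'] at this
  linarith

/-- Among vectors on a finite set with given total mass, the constant one maximizes the entropy. -/
theorem sum_negMulLog_le {ι : Type*} (s : Finset ι) (p : ι → ℝ) (hp : ∀ i ∈ s, 0 ≤ p i) :
    ∑ i ∈ s, negMulLog (p i) ≤
      (∑ i ∈ s, p i) * log s.card + negMulLog (∑ i ∈ s, p i) := by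
  rcases s.eq_empty_or_nonempty with rfl | hs
  · simp
  have hc : (0 : ℝ) < s.card := by exact_mod_cast hs.card_pos
  set P := ∑ i ∈ s, p i with hP
  have hP0 : 0 ≤ P := Finset.sum_nonneg hp
  -- Gibbs' inequality against the uniform vector of the same total mass; the right-hand sides sum
  -- to zero.
  have key : ∀ i ∈ s, p i * log (P / s.card) - p i * log (p i) ≤ P / s.card - p i := by
    intro i hi
    refine mul_log_div_le (hp i hi) (by positivity) fun h => div_pos ?_ hc
    exact h.trans_le (Finset.single_le_sum hp hi)
  have hsum := Finset.sum_le_sum key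
  rw [Finset.sum_sub_distrib, Finset.sum_sub_distrib, ← Finset.sum_mul, ← hP, Finset.sum_const,
    nsmul_eq_mul, mul_div_cancel₀ _ hc.ne', sub_self] at hsum
  have hlog : P * log (P / s.card) = P * log P - P * log s.card := by
    rcases hP0.eq_or_lt with h | h
    · simp [← h]
    · rw [log_div h.ne' hc.ne', mul_sub]
  simp only [negMulLog, neg_mul, Finset.sum_neg_distrib] at *
  linarith

/-- Strong subadditivity of the Shannon entropy. -/
theorem sum_negMulLog_submodular {α β γ : Type*} [Fintype α] [Fintype β] [Fintype γ]
    (p : α → β → γ → ℝ) (hp : ∀ a b c, 0 ≤ p a b c) :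
    (∑ a, ∑ b, ∑ c, negMulLog (p a b c)) + ∑ c, negMulLog (∑ a, ∑ b, p a b c) ≤
      (∑ a, ∑ c, negMulLog (∑ b, p a b c)) + ∑ b, ∑ c, negMulLog (∑ a, p a b c) := by
  set x : α → γ → ℝ := fun a c => ∑ b, p a b c with hx
  set y : β → γ → ℝ := fun b c => ∑ a, p a b c with hy
  set z : γ → ℝ := fun c => ∑ a, ∑ b, p a b c with hz
  have hx0 : ∀ a c, 0 ≤ x a c := fun a c => Finset.sum_nonneg fun b _ => hp a b c
  have hy0 : ∀ b c, 0 ≤ y b c := fun b c => Finset.sum_nonneg fun a _ => hp a b c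
  have hz0 : ∀ c, 0 ≤ z c := fun c => Finset.sum_nonneg fun a _ => hx0 a c
  have hpx : ∀ a b c, p a b c ≤ x a c := fun a b c =>
    Finset.single_le_sum (f := fun b => p a b c) (fun b _ => hp a b c) (Finset.mem_univ b)
  have hpy : ∀ a b c, p a b c ≤ y b c := fun a b c =>
    Finset.single_le_sum (f := fun a => p a b c) (fun a _ => hp a b c) (Finset.mem_univ a)
  have hxz : ∀ a c, x a c ≤ z c := fun a c =>
    Finset.single_le_sum (f := fun a => x a c) (fun a _ => hx0 a c) (Finset.mem_univ a)
  -- Gibbs' inequality against x y / z, the law with the same marginals for which a and b are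
  -- conditionally independent given c. Its total mass is that of p (`e4`).
  have key : ∀ a b c, p a b c * log (x a c) + p a b c * log (y b c) - p a b c * log (z c)
      - p a b c * log (p a b c) ≤ x a c * y b c / z c - p a b c := by
    intro a b c
    have hr : 0 < p a b c → 0 < x a c ∧ 0 < y b c ∧ 0 < z c := fun h =>
      ⟨h.trans_le (hpx a b c), h.trans_le (hpy a b c), (h.trans_le (hpx a b c)).trans_le (hxz a c)⟩
    have h1 := mul_log_div_le (hp a b c) (r := x a c * y b c / z c)
      (div_nonneg (mul_nonneg (hx0 a c) (hy0 b c)) (hz0 c))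
      fun h => div_pos (mul_pos (hr h).1 (hr h).2.1) (hr h).2.2
    rcases (hp a b c).eq_or_lt with h | h
    · simpa [← h] using h1
    · obtain ⟨h2, h3, h4⟩ := hr h
      rw [log_div (mul_pos h2 h3).ne' h4.ne', log_mul h2.ne' h3.ne'] at h1
      linarith
  have hsum := Finset.sum_le_sum fun a (_ : a ∈ Finset.univ) =>
    Finset.sum_le_sum fun b (_ : b ∈ Finset.univ) =>
      Finset.sum_le_sum fun c (_ : c ∈ Finset.univ) => key a b c
  simp only [Finset.sum_sub_distrib, Finset.sum_add_distrib] at hsum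
  have e1 : ∑ a, ∑ b, ∑ c, p a b c * log (x a c) = ∑ a, ∑ c, x a c * log (x a c) := by
    refine Finset.sum_congr rfl fun a _ => ?_
    rw [Finset.sum_comm]
    exact Finset.sum_congr rfl fun c _ => by rw [← Finset.sum_mul]
  have e2 : ∑ a, ∑ b, ∑ c, p a b c * log (y b c) = ∑ b, ∑ c, y b c * log (y b c) := by
    rw [Finset.sum_comm]
    refine Finset.sum_congr rfl fun b _ => ?_
    rw [Finset.sum_comm]
    exact Finset.sum_congr rfl fun c _ => by rw [← Finset.sum_mul]
  have e3 : ∀ g : γ → ℝ, ∑ a, ∑ b, ∑ c, p a b c * g c = ∑ c, z c * g c := by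
    intro g
    calc ∑ a, ∑ b, ∑ c, p a b c * g c = ∑ a, ∑ c, x a c * g c := by
          refine Finset.sum_congr rfl fun a _ => ?_
          rw [Finset.sum_comm]
          exact Finset.sum_congr rfl fun c _ => by rw [← Finset.sum_mul]
      _ = ∑ c, z c * g c := by
          rw [Finset.sum_comm]
          exact Finset.sum_congr rfl fun c _ => by rw [← Finset.sum_mul]
  have e4 : ∑ a, ∑ b, ∑ c, x a c * y b c / z c = ∑ a, ∑ b, ∑ c, p a b c := by
    have h1 := e3 fun _ => 1
    simp only [mul_one] at h1
    rw [h1]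
    have hyz : ∀ c, ∑ b, y b c = z c := fun c => by rw [hz, hy]; exact Finset.sum_comm
    calc ∑ a, ∑ b, ∑ c, x a c * y b c / z c
        = ∑ a, ∑ c, x a c * z c / z c := by
          refine Finset.sum_congr rfl fun a _ => ?_
          rw [Finset.sum_comm]
          refine Finset.sum_congr rfl fun c _ => ?_
          rw [← Finset.sum_div, ← Finset.mul_sum, hyz]
      _ = ∑ c, z c := by
          rw [Finset.sum_comm]
          refine Finset.sum_congr rfl fun c _ => ?_
          rw [← Finset.sum_div, ← Finset.sum_mul]
          rcases eq_or_ne (z c) 0 with h | h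
          · simp [h]
          · exact mul_div_cancel_right₀ _ h
  rw [e1, e2, e3 (fun c => log (z c)), e4] at hsum
  simp only [negMulLog, neg_mul, Finset.sum_neg_distrib]
  linarith

end Shannon

/-- The Shannon entropy of the distribution of a finitely valued function. -/
noncomputable def fnEntropy {Ω ι : Type*} [MeasurableSpace Ω] [Fintype ι] (μ : Measure Ω)
    (F : Ω → ι) : ℝ :=
  ∑ i, Real.negMulLog (μ.real (F ⁻¹' {i}))

section FnEntropy

variable {Ω Ω' ι α β γ : Type*} [MeasurableSpace Ω] [MeasurableSpace Ω'] [Fintype ι] [Fintype α]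
  [Fintype β] [Fintype γ]

theorem fnEntropy_nonneg (μ : Measure Ω) [IsProbabilityMeasure μ] (F : Ω → ι) :
    0 ≤ fnEntropy μ F :=
  Finset.sum_nonneg fun _ _ => Real.negMulLog_nonneg measureReal_nonneg measureReal_le_one

theorem fnEntropy_const (μ : Measure Ω) [IsProbabilityMeasure μ] (i : ι) :
    fnEntropy μ (fun _ => i) = 0 := by
  classical
  refine Finset.sum_eq_zero fun j _ => ?_
  by_cases h : i = j <;> simp [h]

variable [MeasurableSpace ι] [MeasurableSingletonClass ι]
  [MeasurableSpace α] [MeasurableSingletonClass α] [MeasurableSpace β] [MeasurableSingletonClass β]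

/-- A function determined by another one has smaller entropy. -/
theorem fnEntropy_le_of_factorsThrough (μ : Measure Ω) [IsFiniteMeasure μ] {F : Ω → α} {G : Ω → γ}
    (hF : Measurable F) (h : Function.FactorsThrough G F) : fnEntropy μ G ≤ fnEntropy μ F := by
  classical
  rcases isEmpty_or_nonempty Ω with hΩ | ⟨⟨ω⟩⟩
  · simp [fnEntropy, Measure.eq_zero_of_isEmpty μ]
  have : Nonempty γ := ⟨G ω⟩
  obtain ⟨g, rfl⟩ := (Function.factorsThrough_iff G).1 h
  have h1 : ∀ b, μ.real (g ∘ F ⁻¹' {b}) =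
      ∑ a with g a = b, μ.real (F ⁻¹' {a}) := by
    intro b
    rw [sum_measureReal_preimage_singleton _ (fun y _ => hF (measurableSet_singleton y))]
    congr 1
    ext x
    simp
  have h2 : fnEntropy μ F = ∑ b, ∑ a with g a = b, Real.negMulLog (μ.real (F ⁻¹' {a})) :=
    (Finset.sum_fiberwise _ _ _).symm
  rw [h2]
  refine Finset.sum_le_sum fun b _ => ?_
  rw [h1]
  exact negMulLog_sum_le _ _ fun _ _ => measureReal_nonneg

theorem sum_measureReal_inter_fiber (μ : Measure Ω) [IsFiniteMeasure μ] {F : Ω → ι}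
    (hF : Measurable F) (S : Set Ω) : ∑ i, μ.real (S ∩ F ⁻¹' {i}) = μ.real S := by
  classical
  have h := sum_measureReal_preimage_singleton (μ := μ.restrict S) (Finset.univ : Finset ι)
    (f := F) (fun y _ => hF (measurableSet_singleton y))
  simp only [Finset.coe_univ, preimage_univ, measureReal_restrict_apply_univ] at h
  rw [← h]
  refine Finset.sum_congr rfl fun i _ => ?_
  rw [measureReal_restrict_apply (hF (measurableSet_singleton i)), inter_comm]

theorem sum_measureReal_fiber (μ : Measure Ω) [IsProbabilityMeasure μ] {F : Ω → ι}
    (hF : Measurable F) : ∑ i, μ.real (F ⁻¹' {i}) = 1 := by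
  simpa using sum_measureReal_inter_fiber μ hF univ

theorem fnEntropy_le_log_card (μ : Measure Ω) [IsProbabilityMeasure μ] {F : Ω → ι}
    (hF : Measurable F) : fnEntropy μ F ≤ Real.log (Fintype.card ι) := by
  have h := sum_negMulLog_le Finset.univ (fun i => μ.real (F ⁻¹' {i}))
    fun _ _ => measureReal_nonneg
  rw [sum_measureReal_fiber μ hF] at h
  simpa [fnEntropy] using h

theorem fnEntropy_map {μ : Measure Ω} {S : Ω → Ω'} (hS : Measurable S) {F : Ω' → ι}
    (hF : Measurable F) : fnEntropy (μ.map S) F = fnEntropy μ (F ∘ S) :=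
  Finset.sum_congr rfl fun i _ => by
    rw [map_measureReal_apply hS (hF (measurableSet_singleton i)), preimage_comp]

theorem fnEntropy_submodular (μ : Measure Ω) [IsFiniteMeasure μ] {F : Ω → α} {G : Ω → β}
    {K : Ω → γ} (hF : Measurable F) (hG : Measurable G) :
    fnEntropy μ (fun x => (F x, G x, K x)) + fnEntropy μ K ≤
      fnEntropy μ (fun x => (F x, K x)) + fnEntropy μ fun x => (G x, K x) := by
  have h := sum_negMulLog_submodular
    (fun a b c => μ.real ((fun x => (F x, G x, K x)) ⁻¹' {(a, b, c)}))
    fun _ _ _ => measureReal_nonneg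
  have e1 : ∀ a c, ∑ b, μ.real ((fun x => (F x, G x, K x)) ⁻¹' {(a, b, c)}) =
      μ.real ((fun x => (F x, K x)) ⁻¹' {(a, c)}) := by
    intro a c
    rw [← sum_measureReal_inter_fiber μ hG]
    refine Finset.sum_congr rfl fun b _ => congrArg _ ?_
    ext x; simp; tauto
  have e2 : ∀ b c, ∑ a, μ.real ((fun x => (F x, G x, K x)) ⁻¹' {(a, b, c)}) =
      μ.real ((fun x => (G x, K x)) ⁻¹' {(b, c)}) := by
    intro a c
    rw [← sum_measureReal_inter_fiber μ hF]
    refine Finset.sum_congr rfl fun b _ => congrArg _ ?_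
    ext x; simp; tauto
  have e3 : ∀ c, ∑ a, μ.real ((fun x => (F x, K x)) ⁻¹' {(a, c)}) = μ.real (K ⁻¹' {c}) := by
    intro c
    rw [← sum_measureReal_inter_fiber μ hF]
    refine Finset.sum_congr rfl fun b _ => congrArg _ ?_
    ext x; simp; tauto
  simp only [e1, e2, e3] at h
  simpa only [fnEntropy, Fintype.sum_prod_type] using h

theorem fnEntropy_prod_le (μ : Measure Ω) [IsProbabilityMeasure μ] {F : Ω → α} {G : Ω → β}
    (hF : Measurable F) (hG : Measurable G) :
    fnEntropy μ (fun x => (F x, G x)) ≤ fnEntropy μ F + fnEntropy μ G := by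
  have h := fnEntropy_submodular μ (K := fun _ => ()) hF hG
  rw [fnEntropy_const, add_zero] at h
  have h1 : fnEntropy μ (fun x => (F x, G x)) ≤ fnEntropy μ (fun x => (F x, G x, ())) :=
    fnEntropy_le_of_factorsThrough μ (by fun_prop) fun x y h => by simpa using h
  have h2 : fnEntropy μ (fun x => (F x, ())) ≤ fnEntropy μ F :=
    fnEntropy_le_of_factorsThrough μ hF fun x y h => by simpa using h
  have h3 : fnEntropy μ (fun x => (G x, ())) ≤ fnEntropy μ G :=
    fnEntropy_le_of_factorsThrough μ hG fun x y h => by simpa using h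
  linarith

/-- Subadditivity of the conditional entropy `H(F | G) = H(F, G) - H(G)`. -/
theorem fnEntropy_prod_sub_le [MeasurableSpace γ] [MeasurableSingletonClass γ]
    {δ : Type*} [Fintype δ] [MeasurableSpace δ]
    [MeasurableSingletonClass δ] (μ : Measure Ω) [IsFiniteMeasure μ] {F : Ω → α} {F' : Ω → β}
    {G : Ω → γ} {G' : Ω → δ} (hF : Measurable F) (hF' : Measurable F') (hG : Measurable G)
    (hG' : Measurable G') :
    fnEntropy μ (fun x => (F x, F' x, G x, G' x)) - fnEntropy μ (fun x => (G x, G' x)) ≤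
      (fnEntropy μ (fun x => (F x, G x)) - fnEntropy μ G) +
        (fnEntropy μ (fun x => (F' x, G' x)) - fnEntropy μ G') := by
  -- `s1` splits H(F, F' | G, G') into two terms; `s2` and `s3` then drop G' and G from the
  -- conditioning. `g1` and `g2` only reorder components.
  have s1 := fnEntropy_submodular μ (K := fun x => (G x, G' x)) hF hF'
  have s2 := fnEntropy_submodular μ (K := G) hF hG'
  have s3 := fnEntropy_submodular μ (K := G') hF' hG
  have g1 : fnEntropy μ (fun x => (F x, G x, G' x)) ≤ fnEntropy μ (fun x => (F x, G' x, G x)) :=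
    fnEntropy_le_of_factorsThrough μ (hF.prodMk (hG'.prodMk hG)) fun x y h => by
      simp only [Prod.mk_inj] at h ⊢
      tauto
  have g2 : fnEntropy μ (fun x => (G' x, G x)) ≤ fnEntropy μ (fun x => (G x, G' x)) :=
    fnEntropy_le_of_factorsThrough μ (hG.prodMk hG') fun x y h => by
      simp only [Prod.mk_inj] at h ⊢
      tauto
  linarith

end FnEntropy

/-! ### Itineraries -/

/-- The itinerary of length `n` of a point with respect to the partition into fibres of `c`. -/
def itinerary {X ι : Type*} (T : X → X) (c : X → ι) (n : ℕ) (x : X) : Fin n → ι :=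
  fun j => c (T^[j] x)

section Itinerary

variable {X ι κ : Type*}

theorem itinerary_add_eq_iff (T : X → X) (c : X → ι) (m n : ℕ) (x y : X) :
    itinerary T c (m + n) x = itinerary T c (m + n) y ↔
      itinerary T c m x = itinerary T c m y ∧
        itinerary T c n (T^[m] x) = itinerary T c n (T^[m] y) := by
  simp only [funext_iff, itinerary, Fin.forall_fin_add, Fin.val_castAdd, Fin.val_natAdd,
    ← Function.iterate_add_apply, add_comm]

theorem itinerary_eq_iff (T : X → X) (c : X → ι) (n : ℕ) (x y : X) :
    itinerary T c n x = itinerary T c n y ↔ ∀ j < n, c (T^[j] x) = c (T^[j] y) := by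
  simp [funext_iff, itinerary, Fin.forall_iff]

theorem itinerary_of_le {T : X → X} {c : X → ι} {m n : ℕ} (h : m ≤ n) :
    Function.FactorsThrough (itinerary T c m) (itinerary T c n) := fun x y hxy => by
  rw [itinerary_eq_iff] at hxy ⊢
  exact fun j hj => hxy j (hj.trans_le h)

/-- Joins discard empty intersections, whence the nonemptiness on the right. At n = 0 the cover
`{univ}` carries no such condition, so X itself must be nonempty. -/
theorem iterCover_range_fiber [Nonempty X] (T : X → X) (c : X → ι) (n : ℕ) :
    iterCover T (range fun i => c ⁻¹' {i}) n =
      {S | S.Nonempty ∧ ∃ w, S = itinerary T c n ⁻¹' {w}} := by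
  induction n with
  | zero =>
    ext S
    simp only [iterCover, mem_singleton_iff, mem_ofPred_eq]
    have h : ∀ w, itinerary T c 0 ⁻¹' {w} = univ := fun w =>
      eq_univ_of_forall fun x => Subsingleton.elim _ _
    simp only [h, exists_const]
    exact ⟨by rintro rfl; exact ⟨univ_nonempty, rfl⟩, fun h => h.2⟩
  | succ n ih =>
    ext S
    simp only [iterCover, joinCover, ih, mem_ofPred_eq, mem_image, mem_range, exists_exists_eq_and]
    refine and_congr_right fun hS => ⟨?_, ?_⟩
    · rintro ⟨A, ⟨-, w, rfl⟩, i, rfl⟩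
      refine ⟨Fin.snoc w i, ?_⟩
      ext x
      simp only [mem_inter_iff, mem_preimage, mem_singleton_iff, funext_iff, Fin.forall_fin_succ',
        Fin.snoc_castSucc, Fin.snoc_last, itinerary, Fin.val_castSucc, Fin.val_last]
    · rintro ⟨w, rfl⟩
      have e : itinerary T c (n + 1) ⁻¹' {w} =
          itinerary T c n ⁻¹' {fun j => w j.castSucc} ∩ T^[n] ⁻¹' (c ⁻¹' {w (Fin.last n)}) := by
        ext x
        simp only [mem_inter_iff, mem_preimage, mem_singleton_iff, funext_iff, Fin.forall_fin_succ',
          itinerary, Fin.val_castSucc, Fin.val_last]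
      exact ⟨_, ⟨(e ▸ hS).mono inter_subset_left, _, rfl⟩, _, e⟩

variable [MeasurableSpace X]

@[fun_prop]
theorem measurable_itinerary [MeasurableSpace ι] {T : X → X} {c : X → ι} (hT : Measurable T)
    (hc : Measurable c) (n : ℕ) : Measurable (itinerary T c n) :=
  measurable_pi_lambda _ fun j => hc.comp (hT.iterate j)

variable [Fintype ι] [Fintype κ]

/-- Distinct words have distinct nonempty fibres, so a sum over sets becomes a sum over words; empty
fibres contribute `negMulLog 0 = 0`. -/
theorem partitionEntropy_iterCover_range_fiber (T : X → X) (μ : ProbabilityMeasure X) (c : X → ι)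
    (n : ℕ) : partitionEntropy μ (iterCover T (range fun i => c ⁻¹' {i}) n) =
      ENNReal.ofReal (fnEntropy (μ : Measure X) (itinerary T c n)) := by
  classical
  have : Nonempty X := (μ : Measure X).nonempty_of_neZero
  have e : iterCover T (range fun i => c ⁻¹' {i}) n =
      (fun w => itinerary T c n ⁻¹' {w}) '' {w | (itinerary T c n ⁻¹' {w}).Nonempty} := by
    rw [iterCover_range_fiber]
    ext S
    constructor
    · rintro ⟨h, w, rfl⟩
      exact ⟨w, h, rfl⟩
    · rintro ⟨w, h, rfl⟩
      exact ⟨h, w, rfl⟩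
  have hinj : InjOn (fun w => itinerary T c n ⁻¹' {w})
      {w | (itinerary T c n ⁻¹' {w}).Nonempty} := by
    rintro w ⟨x, hx⟩ v - (h : itinerary T c n ⁻¹' {w} = itinerary T c n ⁻¹' {v})
    have hx' : x ∈ itinerary T c n ⁻¹' {v} := h ▸ hx
    exact (mem_singleton_iff.1 hx).symm.trans hx'
  rw [partitionEntropy, e, tsum_image (fun C => ENNReal.ofReal (Real.negMulLog (μ C : ℝ))) hinj,
    tsum_subtype {w | (itinerary T c n ⁻¹' {w}).Nonempty}
      (fun w => ENNReal.ofReal (Real.negMulLog (μ (itinerary T c n ⁻¹' {w}) : ℝ))),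
    tsum_fintype, fnEntropy, ENNReal.ofReal_sum_of_nonneg]
  · refine Finset.sum_congr rfl fun w _ => ?_
    rw [indicator_apply]
    split_ifs with h
    · rfl
    · rw [mem_ofPred_eq, not_nonempty_iff_eq_empty] at h
      simp [h]
  · exact fun _ _ => Real.negMulLog_nonneg measureReal_nonneg measureReal_le_one

variable [MeasurableSpace ι] [MeasurableSpace κ] [MeasurableSingletonClass ι]
  [MeasurableSingletonClass κ]

theorem fnEntropy_itinerary_add_le {T : X → X} (hT : Measurable T) {c : X → ι} (hc : Measurable c)
    (μ : Measure X) [IsProbabilityMeasure μ] (m n : ℕ) :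
    fnEntropy μ (itinerary T c (m + n)) ≤
      fnEntropy μ (itinerary T c m) + fnEntropy μ (itinerary T c n ∘ T^[m]) := by
  have hm := hT.iterate m
  refine le_trans ?_ (fnEntropy_prod_le μ (measurable_itinerary hT hc m)
    ((measurable_itinerary hT hc n).comp hm))
  refine fnEntropy_le_of_factorsThrough μ (by fun_prop) fun x y h => ?_
  rw [Prod.mk_inj] at h
  exact (itinerary_add_eq_iff T c m n x y).2 h

theorem subadditive_fnEntropy_itinerary {T : X → X} {c : X → ι} (hc : Measurable c)
    {μ : Measure X} [IsProbabilityMeasure μ] (hT : MeasurePreserving T μ μ) :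
    Subadditive fun n => fnEntropy μ (itinerary T c n) := fun m n => by
  refine (fnEntropy_itinerary_add_le hT.measurable hc μ m n).trans_eq ?_
  rw [← fnEntropy_map (hT.measurable.iterate m) (measurable_itinerary hT.measurable hc n),
    (hT.iterate m).map_eq]

/-- Comparison of the entropies of two partitions through their conditional entropy. -/
theorem fnEntropy_itinerary_le_add_mul {T : X → X} {c : X → ι} {k : X → κ} (hc : Measurable c)
    (hk : Measurable k) {μ : Measure X} [IsProbabilityMeasure μ] (hT : MeasurePreserving T μ μ)
    (n : ℕ) : fnEntropy μ (itinerary T c n) ≤ fnEntropy μ (itinerary T k n) +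
      n * (fnEntropy μ (fun x => (c x, k x)) - fnEntropy μ k) := by
  have hTm := hT.measurable
  have hcn := fun n => measurable_itinerary hTm hc n
  have hkn := fun n => measurable_itinerary hTm hk n
  have h0 : fnEntropy μ (itinerary T c n) ≤
      fnEntropy μ (fun x => (itinerary T c n x, itinerary T k n x)) :=
    fnEntropy_le_of_factorsThrough μ ((hcn n).prodMk (hkn n)) fun x y h => (Prod.mk_inj.1 h).1
  refine h0.trans ?_
  induction n with
  | zero =>
    have : (fun x => (itinerary T c 0 x, itinerary T k 0 x)) = fun _ => default :=
      funext fun _ => Subsingleton.elim _ _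
    rw [this, fnEntropy_const]
    simpa using fnEntropy_nonneg μ _
  | succ n ih =>
    replace ih := ih (fnEntropy_le_of_factorsThrough μ ((hcn n).prodMk (hkn n))
      fun x y h => (Prod.mk_inj.1 h).1)
    have hi := hTm.iterate n
    have hcn' := hcn n
    have hkn' := hkn n
    -- One more time step raises the conditional entropy of the itineraries by at most that of c ∘
    -- T^n given k ∘ T^n, which by invariance is that of c given k.
    have s1 := fnEntropy_prod_sub_le μ hcn' (hc.comp hi) hkn' (hk.comp hi)
    simp only [Function.comp_apply] at s1
    have e : fnEntropy μ (fun x => (c (T^[n] x), k (T^[n] x))) =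
        fnEntropy μ fun x => (c x, k x) := by
      conv_rhs => rw [← (hT.iterate n).map_eq]
      exact (fnEntropy_map hi (hc.prodMk hk)).symm
    have e' : fnEntropy μ (k ∘ T^[n]) = fnEntropy μ k := by
      conv_rhs => rw [← (hT.iterate n).map_eq]
      exact (fnEntropy_map hi hk).symm
    have g1 : fnEntropy μ (fun x => (itinerary T c (n + 1) x, itinerary T k (n + 1) x)) ≤
        fnEntropy μ (fun x => (itinerary T c n x, c (T^[n] x),
          itinerary T k n x, k (T^[n] x))) := by
      refine fnEntropy_le_of_factorsThrough μ
        (hcn'.prodMk ((hc.comp hi).prodMk (hkn'.prodMk (hk.comp hi)))) fun x y h => ?_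
      simp only [Prod.mk_inj, itinerary_eq_iff, Nat.lt_succ_iff_lt_or_eq] at h ⊢
      exact ⟨fun j hj => hj.elim (h.1 j) fun e => e ▸ h.2.1,
        fun j hj => hj.elim (h.2.2.1 j) fun e => e ▸ h.2.2.2⟩
    have g2 : fnEntropy μ (fun x => (itinerary T k n x, k (T^[n] x))) ≤
        fnEntropy μ (itinerary T k (n + 1)) := by
      refine fnEntropy_le_of_factorsThrough μ (hkn _) fun x y h => ?_
      simp only [Prod.mk_inj, itinerary_eq_iff, Nat.lt_succ_iff_lt_or_eq] at h ⊢
      exact ⟨fun j hj => h j (.inl hj), h n (.inr rfl)⟩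
    push_cast
    linarith

/-- The entropy of long itineraries is controlled by the entropies of all windows of length `q`. -/
theorem mul_fnEntropy_itinerary_le {T : X → X} (hT : Measurable T) {c : X → ι} (hc : Measurable c)
    (μ : Measure X) [IsProbabilityMeasure μ] {q : ℕ} (hq : 0 < q) (n : ℕ) :
    q * fnEntropy μ (itinerary T c n) ≤
      ∑ i ∈ Finset.range n, fnEntropy μ (itinerary T c q ∘ T^[i]) +
        2 * q ^ 2 * Real.log (Fintype.card ι) := by
  have hitin := measurable_itinerary hT hc
  have hlog : ∀ (m : ℕ) (F : X → X), Measurable F →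
      fnEntropy μ (itinerary T c m ∘ F) ≤ m * Real.log (Fintype.card ι) := by
    intro m F hF
    refine (fnEntropy_le_log_card μ ((hitin m).comp hF)).trans_eq ?_
    simp
  have hlog0 : 0 ≤ Real.log (Fintype.card ι) := Real.log_natCast_nonneg _
  -- With n ≤ qJ ≤ n + q, J windows cover the times below n from any starting offset, with at most q
  -- superfluous starting times in total.
  set J := n / q + 1 with hJ
  have hnJ : n ≤ q * J := by
    have := Nat.lt_mul_div_succ n hq
    rw [hJ]; omega
  have hJn : q * J ≤ n + q := by
    have := Nat.mul_div_le n q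
    rw [hJ, mul_add]; omega
  have step : ∀ r J', fnEntropy μ (itinerary T c (r + q * J')) ≤ r * Real.log (Fintype.card ι) +
      ∑ j ∈ Finset.range J', fnEntropy μ (itinerary T c q ∘ T^[q * j + r]) := by
    intro r J'
    induction J' with
    | zero => simpa using hlog r id measurable_id
    | succ J' ih =>
      have := fnEntropy_itinerary_add_le hT hc μ (r + q * J') q
      rw [Finset.sum_range_succ, mul_add, mul_one, ← add_assoc, add_comm (q * J') r]
      linarith
  -- For each offset r, a head of r < q letters is followed by J consecutive windows. Summing over r
  -- uses each starting time below qJ exactly once (`re`). The heads and the superfluous windows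
  -- each cost at most q² log |ι|.
  have hr : ∀ r ∈ Finset.range q, fnEntropy μ (itinerary T c n) ≤
      q * Real.log (Fintype.card ι) +
        ∑ j ∈ Finset.range J, fnEntropy μ (itinerary T c q ∘ T^[q * j + r]) := by
    intro r hr
    have h1 : fnEntropy μ (itinerary T c n) ≤ fnEntropy μ (itinerary T c (r + q * J)) :=
      fnEntropy_le_of_factorsThrough μ (hitin _) (itinerary_of_le (by omega))
    have h2 : (r : ℝ) * Real.log (Fintype.card ι) ≤ q * Real.log (Fintype.card ι) :=
      mul_le_mul_of_nonneg_right (by exact_mod_cast (Finset.mem_range.1 hr).le) hlog0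
    linarith [step r J]
  have hsum := Finset.sum_le_sum hr
  have re : ∀ (f : ℕ → ℝ) (J' : ℕ), ∑ r ∈ Finset.range q, ∑ j ∈ Finset.range J', f (q * j + r) =
      ∑ i ∈ Finset.range (q * J'), f i := by
    intro f J'
    induction J' with
    | zero => simp
    | succ J' ih =>
      simp only [Finset.sum_range_succ, Finset.sum_add_distrib, ih, mul_add, mul_one,
        Finset.sum_range_add]
  rw [Finset.sum_const, Finset.card_range, nsmul_eq_mul, Finset.sum_add_distrib, Finset.sum_const,
    Finset.card_range, nsmul_eq_mul, re (fun i => fnEntropy μ (itinerary T c q ∘ T^[i]))] at hsum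
  have h3 : ∑ i ∈ Finset.range (q * J), fnEntropy μ (itinerary T c q ∘ T^[i]) ≤
      ∑ i ∈ Finset.range (n + q), fnEntropy μ (itinerary T c q ∘ T^[i]) :=
    Finset.sum_le_sum_of_subset_of_nonneg (Finset.range_subset_range.2 hJn)
      fun i _ _ => fnEntropy_nonneg μ _
  have h4 : ∑ i ∈ Finset.range q, fnEntropy μ (itinerary T c q ∘ T^[n + i]) ≤
      q * (q * Real.log (Fintype.card ι)) := by
    refine (Finset.sum_le_card_nsmul _ _ _ fun i _ => hlog q _ (hT.iterate _)).trans_eq ?_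
    simp
  rw [Finset.sum_range_add] at h3
  nlinarith

end Itinerary

/-! ### Entropy of covers -/

section Covers

variable {X : Type*}

theorem toENNReal_log_natCast (m : ℕ) :
    (ENNReal.log (m : ℝ≥0∞)).toENNReal = ENNReal.ofReal (Real.log m) := by
  rcases m.eq_zero_or_pos with rfl | hm
  · simp
  · rw [ENNReal.log_pos_real (by positivity) (by simp), EReal.toENNReal_of_ne_top (by simp)]
    simp

theorem ofReal_le_coverEntropy {Y : Set X} {𝒜 : Set (Set X)} {a : ℝ}
    (h : ∀ ℬ : Set (Set X), ℬ.Finite → ℬ ⊆ traceCover Y 𝒜 → IsCoverOf Y ℬ →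
      a ≤ Real.log ℬ.ncard) : ENNReal.ofReal a ≤ coverEntropy Y 𝒜 := by
  rcases eq_or_ne (coverNumber Y 𝒜) ⊤ with htop | htop
  · simp [coverEntropy, htop]
  obtain ⟨m, hm⟩ := ENat.ne_top_iff_exists.1 htop
  have hlt : coverNumber Y 𝒜 < m + 1 := by
    rw [← hm]; exact_mod_cast Nat.lt_succ_self m
  obtain ⟨ℬ, hℬ⟩ := iInf_lt_iff.1 hlt
  obtain ⟨h1, hℬ⟩ := iInf_lt_iff.1 hℬ
  obtain ⟨h2, hℬ⟩ := iInf_lt_iff.1 hℬ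
  have hfin : ℬ.Finite := finite_of_encard_le_coe (k := m + 1) (by exact_mod_cast hℬ.le)
  have hcard : ℬ.ncard ≤ m := by
    rw [← hfin.cast_ncard_eq] at hℬ
    exact Nat.lt_succ_iff.1 (by exact_mod_cast hℬ)
  have ha := h ℬ hfin h1 h2
  rw [coverEntropy, ← hm, ENat.toENNReal_coe, toENNReal_log_natCast]
  refine ENNReal.ofReal_le_ofReal (ha.trans ?_)
  rcases ℬ.ncard.eq_zero_or_pos with h0 | h0
  · rw [h0]; simpa using Real.log_natCast_nonneg m
  · exact Real.log_le_log (by exact_mod_cast h0) (by exact_mod_cast hcard)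

theorem coverEntropy_le_ofReal_log {Y : Set X} {𝒜 : Set (Set X)} {ι : Type*} (s : Finset ι)
    (f : ι → Set X) (hf : ∀ i ∈ s, f i ∈ 𝒜) (hY : ∀ y ∈ Y, ∃ i ∈ s, y ∈ f i) :
    coverEntropy Y 𝒜 ≤ ENNReal.ofReal (Real.log s.card) := by
  have hle : coverNumber Y 𝒜 ≤ s.card := by
    refine (iInf₂_le ((fun i => Y ∩ f i) '' s) ?_).trans ((iInf_le _ ?_).trans ?_)
    · rintro _ ⟨i, hi, rfl⟩
      exact ⟨f i, hf i hi, rfl⟩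
    · refine Subset.antisymm (sUnion_subset ?_) fun y hy => ?_
      · rintro _ ⟨i, -, rfl⟩
        exact inter_subset_left
      · obtain ⟨i, hi, hyi⟩ := hY y hy
        exact ⟨_, ⟨i, hi, rfl⟩, hy, hyi⟩
    · exact (encard_image_le _ _).trans_eq (encard_coe_eq_coe_finsetCard s)
  rw [← toENNReal_log_natCast, coverEntropy]
  refine EReal.toENNReal_le_toENNReal (ENNReal.log_monotone ?_)
  rw [← ENat.toENNReal_coe]
  exact ENat.toENNReal_le.2 hle

/-- Refinement lowers covering numbers. Only nonempty traces matter, and a point in such a trace can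
later serve as the centre of a ball. -/
theorem coverEntropy_mono {Y Y' : Set X} {𝒜 ℬ : Set (Set X)} (hY : Y ⊆ Y')
    (h : ∀ A ∈ 𝒜, (Y ∩ A).Nonempty → ∃ B ∈ ℬ, Y ∩ A ⊆ B) :
    coverEntropy Y ℬ ≤ coverEntropy Y' 𝒜 := by
  classical
  refine EReal.toENNReal_le_toENNReal (ENNReal.log_monotone (ENat.toENNReal_le.2 ?_))
  refine le_iInf fun 𝒞 => le_iInf fun h𝒞 => le_iInf fun hcov => ?_
  have h' : ∀ C ∈ {C ∈ 𝒞 | (Y ∩ C).Nonempty}, ∃ B ∈ ℬ, Y ∩ C ⊆ B := by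
    rintro C ⟨hC, hne⟩
    obtain ⟨A, hA, rfl⟩ := h𝒞 hC
    have e : Y ∩ (Y' ∩ A) = Y ∩ A := by rw [← inter_assoc, inter_eq_left.2 hY]
    simp only [e] at hne ⊢
    exact h A hA hne
  choose! g hg hsub using h'
  refine (iInf₂_le ((fun C => Y ∩ g C) '' {C ∈ 𝒞 | (Y ∩ C).Nonempty}) ?_).trans
    ((iInf_le _ ?_).trans ((encard_image_le _ _).trans (encard_le_encard (sep_subset _ _))))
  · rintro _ ⟨C, hC, rfl⟩
    exact ⟨_, hg C hC, rfl⟩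
  · refine Subset.antisymm (sUnion_subset ?_) fun y hy => ?_
    · rintro _ ⟨i, -, rfl⟩
      exact inter_subset_left
    · have : y ∈ ⋃₀ 𝒞 := by rw [hcov]; exact hY hy
      obtain ⟨C, hC, hyC⟩ := this
      have hC' : C ∈ {C ∈ 𝒞 | (Y ∩ C).Nonempty} := ⟨hC, y, hy, hyC⟩
      exact ⟨_, ⟨C, hC', rfl⟩, hy, hsub C hC' ⟨hy, hyC⟩⟩

theorem exists_subset_preimage_of_mem_iterCover {T : X → X} {𝒜 : Set (Set X)} {n : ℕ} {S : Set X}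
    (hS : S ∈ iterCover T 𝒜 n) {j : ℕ} (hj : j < n) : ∃ A ∈ 𝒜, S ⊆ T^[j] ⁻¹' A := by
  induction n generalizing S with
  | zero => omega
  | succ n ih =>
    obtain ⟨-, A, hA, _, ⟨B, hB, rfl⟩, rfl⟩ := hS
    rcases Nat.lt_succ_iff_lt_or_eq.1 hj with hj | rfl
    · obtain ⟨A', hA', hsub⟩ := ih hA hj
      exact ⟨A', hA', inter_subset_left.trans hsub⟩
    · exact ⟨B, hB, inter_subset_right⟩

theorem mem_iterCover {T : X → X} {𝒜 : Set (Set X)} {A : ℕ → Set X} (hA : ∀ j, A j ∈ 𝒜) {x : X}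
    (hx : ∀ j, T^[j] x ∈ A j) (n : ℕ) : {y | ∀ j < n, T^[j] y ∈ A j} ∈ iterCover T 𝒜 n := by
  induction n with
  | zero => simp [iterCover]
  | succ n ih =>
    refine ⟨⟨x, fun j _ => hx j⟩, _, ih, _, ⟨A n, hA n, rfl⟩, ?_⟩
    ext y
    simp only [mem_ofPred_eq, mem_inter_iff, mem_preimage, Nat.lt_succ_iff_lt_or_eq]
    exact ⟨fun h => ⟨fun j hj => h j (.inl hj), h n (.inr rfl)⟩,
      fun h j hj => hj.elim (h.1 j) fun e => e ▸ h.2⟩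

/-- Positivity of ε is needed at n = 0, where the supremum over the empty type is 0. -/
theorem iterDist_lt_iff {T : X → X} {d : X → X → ℝ} {n : ℕ} {ε : ℝ} (hε : 0 < ε) {x y : X} :
    iterDist T d n x y < ε ↔ ∀ j < n, d (T^[j] x) (T^[j] y) < ε := by
  rcases n.eq_zero_or_pos with rfl | hn
  · simp [iterDist, hε]
  · have : Nonempty (Fin n) := ⟨⟨0, hn⟩⟩
    refine ⟨fun h j hj => (le_ciSup (f := fun j : Fin n => d (T^[(j : ℕ)] x) (T^[(j : ℕ)] y))
      (Set.finite_range _).bddAbove ⟨j, hj⟩).trans_lt h, fun h => ?_⟩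
    obtain ⟨j, hj⟩ := exists_eq_ciSup_of_finite
      (f := fun j : Fin n => d (T^[(j : ℕ)] x) (T^[(j : ℕ)] y))
    rw [iterDist, ← hj]
    exact h j j.2

theorem bowenEntropy_le_dEntropy [TopologicalSpace X] (d : X → X → ℝ) (T : X → X) :
    bowenEntropy d T ≤ dEntropy d T := by
  refine iSup₂_mono fun ε _ => iSup₂_le fun K _ => limsup_le_limsup (Eventually.of_forall
    fun n => ENNReal.div_le_div_right ?_ _)
  exact coverEntropy_mono (subset_univ K) fun A hA _ => ⟨A, hA, inter_subset_right⟩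

end Covers

/-! ### Measure entropy is at most Bowen entropy -/

section Bowen

variable {X ι : Type*}

/-- Each atom is cut along S: at most |W| pieces meet S, and the pieces off S have total mass μ(Sᶜ).
The constant 2 bounds `negMulLog` of the two total masses. -/
theorem fnEntropy_le_log_card_add [MeasurableSpace X] [Fintype ι] [MeasurableSpace ι]
    [MeasurableSingletonClass ι] (μ : Measure X) [IsProbabilityMeasure μ] {F : X → ι}
    (hF : Measurable F) {S : Set X} (hS : MeasurableSet S) (W : Finset ι)
    (hW : ∀ x ∈ S, F x ∈ W) :
    fnEntropy μ F ≤ Real.log W.card + μ.real Sᶜ * Real.log (Fintype.card ι) + 2 := by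
  have hη : ∀ A : Set X, Real.negMulLog (μ.real A) ≤ 1 := fun A =>
    (Real.negMulLog_le_one_sub_self measureReal_nonneg).trans 
      (by linarith [measureReal_nonneg (μ := μ) (s := A)])
  have h1 : ∀ i, Real.negMulLog (μ.real (F ⁻¹' {i})) ≤
      Real.negMulLog (μ.real (S ∩ F ⁻¹' {i})) + Real.negMulLog (μ.real (Sᶜ ∩ F ⁻¹' {i})) := by
    intro i
    rw [← measureReal_inter_add_sdiff (s := F ⁻¹' {i}) hS, inter_comm, Set.sdiff_eq,
      inter_comm _ Sᶜ]
    exact negMulLog_add_le measureReal_nonneg measureReal_nonneg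
  have hsub : ∀ i ∉ W, μ.real (S ∩ F ⁻¹' {i}) = 0 := by
    intro i hi
    have : S ∩ F ⁻¹' {i} = ∅ := by
      refine eq_empty_of_forall_notMem fun x hx => hi ?_
      rw [← mem_singleton_iff.1 hx.2]
      exact hW x hx.1
    simp [this]
  have h2 : ∑ i, Real.negMulLog (μ.real (S ∩ F ⁻¹' {i})) ≤ Real.log W.card + 1 := by
    rw [← Finset.sum_subset (Finset.subset_univ W) fun i _ hi => by rw [hsub i hi]; simp]
    refine (sum_negMulLog_le W _ fun _ _ => measureReal_nonneg).trans ?_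
    rw [Finset.sum_subset (Finset.subset_univ W) fun i _ hi => hsub i hi,
      sum_measureReal_inter_fiber μ hF]
    have := mul_le_mul_of_nonneg_right (measureReal_le_one (μ := μ) (s := S))
      (Real.log_natCast_nonneg W.card)
    linarith [hη S]
  have h3 : ∑ i, Real.negMulLog (μ.real (Sᶜ ∩ F ⁻¹' {i})) ≤
      μ.real Sᶜ * Real.log (Fintype.card ι) + 1 := by
    refine (sum_negMulLog_le Finset.univ _ fun _ _ => measureReal_nonneg).trans ?_
    rw [sum_measureReal_inter_fiber μ hF, Finset.card_univ]
    linarith [hη Sᶜ]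
  have h4 := Finset.sum_le_sum fun i (_ : i ∈ Finset.univ) => h1 i
  rw [Finset.sum_add_distrib] at h4
  rw [fnEntropy]
  linarith

/-- The coding of a point by a family of sets: the index `c x` is kept on the set `K (c x)`. -/
noncomputable def partialCode (c : X → ι) (K : ι → Set X) (x : X) : ι ⊕ Unit :=
  open Classical in if x ∈ K (c x) then .inl (c x) else .inr ()

theorem partialCode_eq_inl {c : X → ι} {K : ι → Set X} {x : X} {i : ι} :
    partialCode c K x = .inl i ↔ c x = i ∧ x ∈ K i := by
  unfold partialCode
  split_ifs with h
  · rw [Sum.inl.injEq]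
    exact ⟨fun e => ⟨e, e ▸ h⟩, fun e => e.1⟩
  · simp only [false_iff, not_and]
    rintro rfl
    exact h

theorem partialCode_eq_inr {c : X → ι} {K : ι → Set X} {x : X} :
    partialCode c K x = .inr () ↔ x ∉ K (c x) := by
  unfold partialCode
  split_ifs with h <;> simp [h]

theorem preimage_partialCode_inl {c : X → ι} {K : ι → Set X} (hK : ∀ i, K i ⊆ c ⁻¹' {i}) (i : ι) :
    partialCode c K ⁻¹' {.inl i} = K i := by
  ext x
  rw [mem_preimage, mem_singleton_iff, partialCode_eq_inl]
  exact ⟨fun h => h.2, fun h => ⟨hK i h, h⟩⟩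

variable [MeasurableSpace X] [Fintype ι]

theorem measurable_partialCode [MeasurableSpace ι] {c : X → ι} {K : ι → Set X}
    (hK : ∀ i, K i ⊆ c ⁻¹' {i})
    (hKm : ∀ i, MeasurableSet (K i)) : Measurable (partialCode c K) := by
  refine measurable_to_countable' ?_
  have h : ∀ i, MeasurableSet (partialCode c K ⁻¹' {.inl i}) := fun i => by
    rw [preimage_partialCode_inl hK]; exact hKm i
  rintro (i | ⟨⟨⟩⟩)
  · exact h i
  · convert (MeasurableSet.iUnion h).compl using 1
    ext x
    simp only [mem_preimage, mem_singleton_iff, mem_compl_iff, mem_iUnion]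
    rcases partialCode c K x with i | ⟨⟨⟩⟩ <;> simp

/-- The partial code leaves `c` unknown only where it is `inr`. The left side is therefore the sum
on the right minus the nonnegative term of the `inr` fibre. -/
theorem fnEntropy_partialCode_sub_le (μ : Measure X) [IsProbabilityMeasure μ] {c : X → ι}
    {K : ι → Set X} (hK : ∀ i, K i ⊆ c ⁻¹' {i}) :
    fnEntropy μ (fun x => (c x, partialCode c K x)) - fnEntropy μ (partialCode c K) ≤
      ∑ i, Real.negMulLog (μ.real (c ⁻¹' {i} \ K i)) := by
  classical
  have h0 : 0 ≤ Real.negMulLog (μ.real (partialCode c K ⁻¹' {.inr ()})) :=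
    Real.negMulLog_nonneg measureReal_nonneg measureReal_le_one
  have h1 : ∀ i j, μ.real ((fun x => (c x, partialCode c K x)) ⁻¹' {(i, .inl j)}) =
      if j = i then μ.real (K i) else 0 := by
    intro i j
    split_ifs with h
    · subst h
      congr 1
      ext x
      simp only [mem_preimage, mem_singleton_iff, Prod.mk_inj, partialCode_eq_inl]
      exact ⟨fun h => h.2.2, fun h => ⟨hK j h, hK j h, h⟩⟩
    · have : (fun x => (c x, partialCode c K x)) ⁻¹' {(i, .inl j)} = ∅ := by
        refine eq_empty_of_forall_notMem fun x hx => h ?_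
        simp only [mem_preimage, mem_singleton_iff, Prod.mk_inj, partialCode_eq_inl] at hx
        exact hx.2.1.symm.trans hx.1
      simp [this]
  have h2 : ∀ i, (fun x => (c x, partialCode c K x)) ⁻¹' {(i, .inr ())} = c ⁻¹' {i} \ K i := by
    intro i
    ext x
    simp only [mem_preimage, mem_singleton_iff, Prod.mk_inj, partialCode_eq_inr, Set.mem_sdiff]
    refine and_congr_right ?_
    rintro rfl
    rfl
  simp only [fnEntropy, Fintype.sum_prod_type, Fintype.sum_sum_type, h1, h2,
    preimage_partialCode_inl hK, Finset.univ_unique, Finset.sum_singleton, Finset.sum_add_distrib,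
    apply_ite Real.negMulLog, Real.negMulLog_zero, Finset.sum_ite_eq', Finset.mem_univ, if_true]
  have : (default : Unit) = () := rfl
  rw [this]
  linarith

/-- Inner regularity makes each of the |ι| error terms smaller than 1 / (|ι| + 1). -/
theorem exists_isCompact_partialCode [MeasurableSpace ι] [MeasurableSingletonClass ι] 
    [TopologicalSpace X] [BorelSpace X] [T2Space X]
    (μ : Measure X) [IsProbabilityMeasure μ] [μ.Regular] {c : X → ι} (hc : Measurable c) :
    ∃ K : ι → Set X, (∀ i, IsCompact (K i)) ∧ (∀ i, K i ⊆ c ⁻¹' {i}) ∧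
      fnEntropy μ (fun x => (c x, partialCode c K x)) - fnEntropy μ (partialCode c K) ≤ 1 := by
  set a : ℝ := 1 / (Fintype.card ι + 1) with ha
  have ha0 : 0 < a := by positivity
  have hη : ∀ᶠ x in 𝓝 (0 : ℝ), Real.negMulLog x < a := by
    have := Real.continuous_negMulLog.tendsto 0
    rw [Real.negMulLog_zero] at this
    exact this.eventually_lt_const ha0
  obtain ⟨δ, hδ, hδη⟩ := Metric.eventually_nhds_iff.1 hη
  have h : ∀ i, ∃ K ⊆ c ⁻¹' {i}, IsCompact K ∧ μ (c ⁻¹' {i} \ K) < ENNReal.ofReal δ := fun i =>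
    (hc (measurableSet_singleton i)).exists_isCompact_sdiff_lt (measure_ne_top μ _)
      (by simpa using hδ)
  choose K hK hKc hKμ using h
  refine ⟨K, hKc, hK, (fnEntropy_partialCode_sub_le μ hK).trans ?_⟩
  refine (Finset.sum_le_card_nsmul _ _ a fun i _ => (hδη ?_).le).trans ?_
  · rw [Real.dist_0_eq_abs, abs_of_nonneg measureReal_nonneg]
    exact (ENNReal.lt_ofReal_iff_toReal_lt (measure_ne_top μ _)).1 (hKμ i)
  · rw [nsmul_eq_mul, ha, Finset.card_univ, mul_one_div, div_le_one (by positivity)]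
    linarith

end Bowen

section Bowen

variable {X ι : Type*}

/-- Finitely many disjoint compact sets have mutual distances at least 2ε for small ε, so no ε-ball
meets two of them. -/
theorem exists_forall_dist_lt_imp_eq [MetricSpace X] [Finite ι] {K : ι → Set X}
    (hK : ∀ i, IsCompact (K i)) (hd : Pairwise fun i j => Disjoint (K i) (K j)) :
    ∃ ε > 0, ∀ x, ∀ i j, ∀ y ∈ K i, ∀ z ∈ K j, dist x y < ε → dist x z < ε → i = j := by
  have h : ∀ᶠ ε in 𝓝[>] (0 : ℝ), ∀ i j, i ≠ j → ∀ y ∈ K i, ∀ z ∈ K j, 2 * ε ≤ dist y z := by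
    refine eventually_all.2 fun i => eventually_all.2 fun j => ?_
    by_cases hij : i = j
    · simp [hij]
    obtain ⟨r, hr, hlt⟩ := Metric.exists_pos_forall_lt_edist (hK i) (hK j).isClosed (hd hij)
    filter_upwards [Ioo_mem_nhdsGT (half_pos (NNReal.coe_pos.2 hr))] with ε hε _ y hy z hz
    have h1 := hlt y hy z hz
    rw [edist_nndist, ENNReal.coe_lt_coe, ← NNReal.coe_lt_coe, coe_nndist] at h1
    linarith [hε.2]
  obtain ⟨ε, hε, hε0⟩ := (h.and self_mem_nhdsWithin).exists
  refine ⟨ε, hε0, fun x i j y hy z hz hxy hxz => by_contra fun hij => ?_⟩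
  have := hε i j hij y hy z hz
  linarith [dist_triangle_left y z x]

/-- Up to the choice of the times at which the code is defined, a ball of the `n`-th iterated
metric meets a single word of codes with respect to separated compact sets. -/
theorem card_le_of_cover_balls {d : X → X → ℝ} {T : X → X} {c : X → ι} {K : ι → Set X} {ε : ℝ}
    (hε : 0 < ε)
    (hsep : ∀ x, ∀ i j, ∀ y ∈ K i, ∀ z ∈ K j, d x y < ε → d x z < ε → i = j) {L : Set X} {n : ℕ}
    {ℬ : Set (Set X)} (hfin : ℬ.Finite) (hsub : ℬ ⊆ traceCover L (balls (iterDist T d n) ε))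
    (hcov : IsCoverOf L ℬ) {W : Finset (Fin n → ι ⊕ Unit)}
    (hW : ∀ w ∈ W, ∃ x ∈ L, itinerary T (partialCode c K) n x = w) :
    W.card ≤ ℬ.ncard * 2 ^ n := by
  classical
  rcases W.eq_empty_or_nonempty with rfl | ⟨w₀, hw₀⟩
  · simp
  have : Nonempty X := ⟨(hW w₀ hw₀).choose⟩
  choose! x hxL hxw using hW
  have hB : ∀ w ∈ W, ∃ B ∈ ℬ, x w ∈ B := fun w hw => by
    have : x w ∈ ⋃₀ ℬ := by rw [hcov]; exact hxL w hw
    exact this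
  choose! B hBℬ hxB using hB
  have hcard : (hfin.toFinset ×ˢ (Finset.univ : Finset (Fin n → Bool))).card = ℬ.ncard * 2 ^ n := by
    rw [Finset.card_product, ncard_eq_toFinset_card _ hfin]
    simp
  rw [← hcard]
  -- A word is recovered from a ball containing a point that realizes it and from the set of times
  -- at which its code is defined.
  refine Finset.card_le_card_of_injOn (fun w => (B w, fun j => (w j).isLeft)) ?_ ?_
  · intro w hw
    simpa using hBℬ w hw
  · intro w hw v hv h
    simp only [Prod.mk_inj] at h
    obtain ⟨hBB, hl⟩ := h
    obtain ⟨_, ⟨z, rfl⟩, hz⟩ := hsub (hBℬ w hw)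
    have h1 := hxB w hw
    have h2 := hxB v hv
    rw [← hBB] at h2
    rw [← hz] at h1 h2
    have h1' := (iterDist_lt_iff hε).1 h1.2
    have h2' := (iterDist_lt_iff hε).1 h2.2
    funext j
    have e1 := congrFun (hxw w hw) j
    have e2 := congrFun (hxw v hv) j
    have el := congrFun hl j
    cases hwj : w j with
    | inl i =>
      cases hvj : v j with
      | inl i' =>
        rw [hwj, itinerary, partialCode_eq_inl] at e1
        rw [hvj, itinerary, partialCode_eq_inl] at e2
        rw [hsep _ i i' _ e1.2 _ e2.2 (h1' j j.2) (h2' j j.2)]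
      | inr _ => simp [hwj, hvj] at el
    | inr _ =>
      cases hvj : v j with
      | inl i' => simp [hwj, hvj] at el
      | inr _ => rfl

theorem iterDist_mul_lt {T : X → X} {d : X → X → ℝ} {m n : ℕ} (hm : 0 < m) {ε : ℝ} (hε : 0 < ε)
    {x y : X} (h : iterDist T d (m * n) x y < ε) : iterDist T^[m] d n x y < ε := by
  rw [iterDist_lt_iff hε] at h ⊢
  intro j hj
  rw [← Function.iterate_mul]
  exact h _ (Nat.mul_lt_mul_of_pos_left hj hm)

variable [MeasurableSpace X] [Fintype ι] [MeasurableSpace ι] [MeasurableSingletonClass ι]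

/-- The error 3n collects the conditional entropy of the partition given the code, the factor 2^n of
undefined times, and the words seen off L, each at most n. The 2 comes from
`fnEntropy_le_log_card_add`. -/
theorem exists_fnEntropy_itinerary_le_coverEntropy_add [MetricSpace X] [BorelSpace X]
    {μ : Measure X} [IsProbabilityMeasure μ] [μ.Regular] {T : X → X} (hT : MeasurePreserving T μ μ)
    {c : X → ι} (hc : Measurable c) :
    ∃ ε > 0, ∃ L : Set X, IsCompact L ∧ ∀ n, ENNReal.ofReal (fnEntropy μ (itinerary T c n)) ≤
      coverEntropy L (balls (iterDist T dist n) ε) + ENNReal.ofReal (3 * n + 2) := by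
  classical
  have : MeasurableSingletonClass (ι ⊕ Unit) := ⟨by
    rintro (i | i)
    · simpa using (measurableSet_singleton i).inl_image (β := Unit)
    · simpa using (measurableSet_singleton i).inr_image (α := ι)⟩
  obtain ⟨K, hKc, hK, hcond⟩ := exists_isCompact_partialCode μ hc
  have hk := measurable_partialCode hK fun i => (hKc i).measurableSet
  obtain ⟨ε, hε, hsep⟩ := exists_forall_dist_lt_imp_eq hKc fun i j hij =>
    (((disjoint_singleton.2 hij).preimage c).mono (hK i) (hK j))
  set ℓ := Real.log (Fintype.card (ι ⊕ Unit)) with hℓ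
  have hℓ0 : 0 ≤ ℓ := Real.log_natCast_nonneg _
  -- There are exp(nℓ) words, so mass below 1 / (ℓ + 1) off L keeps their contribution at most n.
  obtain ⟨L, -, hL, hLμ⟩ := MeasurableSet.univ.exists_isCompact_sdiff_lt
    (measure_ne_top μ _) (ε := ENNReal.ofReal (1 / (ℓ + 1))) (by simp; positivity)
  have hLμ' : μ.real Lᶜ * ℓ ≤ 1 := by
    rw [← compl_eq_univ_sdiff] at hLμ
    have h1 := ((ENNReal.lt_ofReal_iff_toReal_lt (measure_ne_top μ _)).1 hLμ).le
    have h2 := mul_le_mul_of_nonneg_right h1 hℓ0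
    refine h2.trans ?_
    rw [one_div_mul_eq_div, div_le_one (by positivity)]
    linarith
  refine ⟨ε, hε, L, hL, fun n => ?_⟩
  rw [← tsub_le_iff_right, ← ENNReal.ofReal_sub _ (by positivity)]
  refine ofReal_le_coverEntropy fun ℬ hfin hsub hcov => ?_
  set W : Finset (Fin n → ι ⊕ Unit) :=
    Finset.univ.filter fun w => ∃ x ∈ L, itinerary T (partialCode c K) n x = w
  have hcard := card_le_of_cover_balls hε hsep hfin hsub hcov (W := W) fun w hw =>
    (Finset.mem_filter.1 hw).2
  have h1 := fnEntropy_itinerary_le_add_mul hc hk hT n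
  have h2 := fnEntropy_le_log_card_add μ (measurable_itinerary hT.measurable hk n)
    hL.measurableSet W fun x hx => Finset.mem_filter.2 ⟨Finset.mem_univ _, x, hx, rfl⟩
  have h3 : Real.log W.card ≤ Real.log ℬ.ncard + n := by
    rcases W.card.eq_zero_or_pos with h0 | h0
    · rw [h0]
      have := Real.log_natCast_nonneg ℬ.ncard
      simp only [Nat.cast_zero, Real.log_zero]
      positivity
    · have hpos : 0 < ℬ.ncard := Nat.pos_of_mul_pos_right (h0.trans_le hcard)
      have h4 : Real.log W.card ≤ Real.log ((ℬ.ncard : ℝ) * 2 ^ n) :=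
        Real.log_le_log (by exact_mod_cast h0) (by exact_mod_cast hcard)
      rw [Real.log_mul (by positivity) (by positivity), Real.log_pow] at h4
      have h5 : (n : ℝ) * Real.log 2 ≤ n * 1 :=
        mul_le_mul_of_nonneg_left (by linarith [Real.log_two_lt_d9]) (Nat.cast_nonneg n)
      linarith
  have h6 : μ.real Lᶜ * Real.log (Fintype.card (Fin n → ι ⊕ Unit)) ≤ n := by
    rw [Fintype.card_fun, Fintype.card_fin, Nat.cast_pow, Real.log_pow, ← hℓ]
    calc μ.real Lᶜ * (n * ℓ) = n * (μ.real Lᶜ * ℓ) := by ring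
      _ ≤ n * 1 := mul_le_mul_of_nonneg_left hLμ' (Nat.cast_nonneg n)
      _ = n := mul_one _
  have h7 : (n : ℝ) * (fnEntropy μ (fun x => (c x, partialCode c K x)) -
      fnEntropy μ (partialCode c K)) ≤ n * 1 :=
    mul_le_mul_of_nonneg_left hcond (Nat.cast_nonneg n)
  linarith

theorem fnEntropy_itinerary_mul_le {T : X → X} (hT : Measurable T) {c : X → ι} (hc : Measurable c)
    (μ : Measure X) [IsProbabilityMeasure μ] {m : ℕ} (hm : 0 < m) (n : ℕ) :
    fnEntropy μ (itinerary T c (m * n)) ≤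
      fnEntropy μ (itinerary T^[m] (itinerary T c m) n) := by
  refine fnEntropy_le_of_factorsThrough μ
    (measurable_itinerary (hT.iterate m) (measurable_itinerary hT hc m) n) fun x y h => ?_
  simp only [itinerary_eq_iff, ← Function.iterate_mul, ← Function.iterate_add_apply] at h ⊢
  intro j hj
  have := h (j / m) (Nat.div_lt_of_lt_mul hj) (j % m) (Nat.mod_lt _ hm)
  rwa [Nat.mod_add_div] at this

/-- The previous estimate is applied to T^m with words of length m as letters; `iterDist T d (m *
n)` dominates the n-th iterated metric of T^m. After division by mn the error is at most 5 / m, and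
m tends to infinity. -/
theorem entropyOfPartition_le_bowenEntropy [MetricSpace X] [BorelSpace X]
    {μ : ProbabilityMeasure X} [(μ : Measure X).Regular] {T : X → X}
    (hT : MeasurePreserving T (μ : Measure X) μ) {c : X → ι} (hc : Measurable c) :
    entropyOfPartition T μ (range fun i => c ⁻¹' {i}) ≤ bowenEntropy dist T := by
  set u : ℕ → ℝ := fun n => fnEntropy (μ : Measure X) (itinerary T c n) with hu
  have hsub : Subadditive u := subadditive_fnEntropy_itinerary hc hT
  have hbdd : BddBelow (range fun n => u n / n) := by
    refine ⟨0, ?_⟩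
    rintro _ ⟨n, rfl⟩
    exact div_nonneg (fnEntropy_nonneg _ _) (Nat.cast_nonneg n)
  have hlim := hsub.tendsto_lim hbdd
  have hlim' := (ENNReal.continuous_ofReal.tendsto _).comp hlim
  have hdiv : ∀ (a : ℝ) (n : ℕ), 0 < n →
      ENNReal.ofReal a / n = ENNReal.ofReal (a / n) := fun a n hn => by
    rw [ENNReal.ofReal_div_of_pos (by exact_mod_cast hn), ENNReal.ofReal_natCast]
  have hL : entropyOfPartition T μ (range fun i => c ⁻¹' {i}) = ENNReal.ofReal hsub.lim := by
    refine Tendsto.limsup_eq (hlim'.congr' ?_)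
    filter_upwards [eventually_gt_atTop 0] with n hn
    rw [partitionEntropy_iterCover_range_fiber, hdiv _ _ hn]
    rfl
  rw [hL]
  refine le_of_forall_gt_imp_ge_of_dense fun t ht => ?_
  have key : ∀ m : ℕ, 0 < m → ENNReal.ofReal hsub.lim ≤ t + ENNReal.ofReal (5 / m) := by
    intro m hm
    have hm' : (0 : ℝ) < m := by exact_mod_cast hm
    obtain ⟨ε, hε, K, hK, hle⟩ := exists_fnEntropy_itinerary_le_coverEntropy_add (hT.iterate m)
      (measurable_itinerary hT.measurable hc m)
    have hB : limsup (fun n : ℕ => coverEntropy K (balls (iterDist T dist n) ε) / (n : ℝ≥0∞)) atTop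
        < t := by
      refine lt_of_le_of_lt ?_ ht
      exact le_trans (le_iSup₂ (f := fun (K : Set X) (_ : IsCompact K) => limsup (fun n : ℕ =>
        coverEntropy K (balls (iterDist T dist n) ε) / (n : ℝ≥0∞)) atTop) K hK)
        (le_iSup₂ (f := fun (ε : ℝ) (_ : 0 < ε) => ⨆ K : Set X, ⨆ _ : IsCompact K,
          limsup (fun n : ℕ => coverEntropy K (balls (iterDist T dist n) ε) / (n : ℝ≥0∞)) atTop)
          ε hε)
    have hmul : Tendsto (fun n => m * n) atTop atTop := tendsto_id.const_mul_atTop' hm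
    refine le_of_tendsto (hlim'.comp hmul) ?_
    filter_upwards [hmul.eventually (eventually_lt_of_limsup_lt hB), eventually_gt_atTop 0]
      with n hn hn0
    have hmn : 0 < m * n := Nat.mul_pos hm hn0
    have h1 : ENNReal.ofReal (u (m * n)) ≤
        coverEntropy K (balls (iterDist T dist (m * n)) ε) + ENNReal.ofReal (3 * n + 2) := by
      refine (ENNReal.ofReal_le_ofReal
        (fnEntropy_itinerary_mul_le hT.measurable hc _ hm n)).trans ((hle n).trans ?_)
      gcongr
      refine coverEntropy_mono Subset.rfl ?_
      rintro _ ⟨z, rfl⟩ -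
      exact ⟨_, ⟨z, rfl⟩, fun y hy => iterDist_mul_lt hm hε hy.2⟩
    have h2 := ENNReal.div_le_div_right h1 ((m * n : ℕ) : ℝ≥0∞)
    rw [ENNReal.add_div, hdiv _ _ hmn, hdiv _ _ hmn] at h2
    refine h2.trans (add_le_add hn.le (ENNReal.ofReal_le_ofReal ?_))
    have hn1 : (1 : ℝ) ≤ n := by exact_mod_cast hn0
    push_cast
    rw [div_le_div_iff₀ (by positivity) hm']
    nlinarith
  have h0 : Tendsto (fun m : ℕ => t + ENNReal.ofReal (5 / m)) atTop (𝓝 (t + ENNReal.ofReal 0)) :=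
    tendsto_const_nhds.add
      ((ENNReal.continuous_ofReal.tendsto _).comp (tendsto_const_div_atTop_nhds_zero_nat 5))
  rw [ENNReal.ofReal_zero, add_zero] at h0
  exact ge_of_tendsto h0 ((eventually_gt_atTop 0).mono key)

end Bowen

theorem IsFinitePartition.exists_eq_range_fiber {X : Type*} [MeasurableSpace X] {𝒞 : Set (Set X)}
    (h : IsFinitePartition 𝒞) :
    ∃ (N : ℕ) (c : X → Fin N), Measurable c ∧ 𝒞 = range fun i => c ⁻¹' {i} := by
  have := h.finite.to_subtype
  obtain ⟨N, ⟨e⟩⟩ := Finite.exists_equiv_fin 𝒞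
  have hx : ∀ x, ∃ C : 𝒞, x ∈ (C : Set X) := fun x => by
    have : x ∈ ⋃₀ 𝒞 := by rw [h.isCover]; trivial
    obtain ⟨C, hC, hxC⟩ := this
    exact ⟨⟨C, hC⟩, hxC⟩
  choose f hf using hx
  have hfib : ∀ i, (fun x => e (f x)) ⁻¹' {i} = (e.symm i : Set X) := by
    intro i
    ext x
    simp only [mem_preimage, mem_singleton_iff, ← Equiv.eq_symm_apply]
    refine ⟨fun hx => hx ▸ hf x, fun hx => Subtype.ext (by_contra fun hne => ?_)⟩
    exact disjoint_left.1 (h.disjoint _ (f x).2 _ (e.symm i).2 hne) (hf x) hx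
  refine ⟨N, fun x => e (f x), measurable_to_countable' fun i => ?_, ?_⟩
  · rw [hfib]
    exact h.measurableSet _ (e.symm i).2
  · simp only [hfib]
    ext C
    exact ⟨fun hC => ⟨e ⟨C, hC⟩, by simp⟩, by rintro ⟨i, rfl⟩; exact (e.symm i).2⟩

theorem IsCompatibleMetric.supKolmogorovSinaiEntropy_le {X : Type*} [TopologicalSpace X]
    [MeasurableSpace X] [BorelSpace X] {d : X → X → ℝ} (hd : IsCompatibleMetric d) (T : X → X) :
    supKolmogorovSinaiEntropy T ≤ bowenEntropy d T := by
  -- This structure keeps the given topology definitionally, so `BorelSpace X` still applies.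
  let _ : MetricSpace X := MetricSpace.ofDistTopology d hd.dist_self hd.dist_comm hd.dist_triangle
    hd.isOpen_iff hd.eq_of_dist_eq_zero
  refine iSup_le fun μ => iSup₂_le fun hμ hT => iSup₂_le fun 𝒞 h𝒞 => ?_
  obtain ⟨N, c, hc, rfl⟩ := h𝒞.exists_eq_range_fiber
  exact entropyOfPartition_le_bowenEntropy hT hc

/-! ### Limits of empirical measures -/

section Average

variable {Ω κ : Type*} [MeasurableSpace Ω]

/-- The arithmetic mean of a finite family of measures. -/
noncomputable def average (I : Finset κ) (m : κ → Measure Ω) : Measure Ω :=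
  (I.card : ℝ≥0∞)⁻¹ • ∑ i ∈ I, m i

theorem isProbabilityMeasure_average {I : Finset κ} (hI : I.Nonempty) {m : κ → Measure Ω}
    (hm : ∀ i, IsProbabilityMeasure (m i)) : IsProbabilityMeasure (average I m) := ⟨by
  simp only [average, Measure.smul_apply, Measure.coe_finsetSum, Finset.sum_apply, measure_univ,
    Finset.sum_const, nsmul_eq_mul, mul_one, smul_eq_mul]
  exact ENNReal.inv_mul_cancel (by simpa using hI.ne_empty) (by simp)⟩

theorem average_real_apply (I : Finset κ) {m : κ → Measure Ω}
    (hm : ∀ i, IsProbabilityMeasure (m i)) (A : Set Ω) :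
    (average I m).real A = (I.card : ℝ)⁻¹ * ∑ i ∈ I, (m i).real A := by
  simp only [average, Measure.real, Measure.smul_apply, Measure.coe_finsetSum, Finset.sum_apply,
    smul_eq_mul, ENNReal.toReal_mul, ENNReal.toReal_inv, ENNReal.toReal_natCast]
  rw [ENNReal.toReal_sum fun i _ => measure_ne_top _ _]

theorem integral_average (I : Finset κ) {m : κ → Measure Ω} {f : Ω → ℝ}
    (hf : ∀ i, Integrable f (m i)) :
    ∫ x, f x ∂(average I m) = (I.card : ℝ)⁻¹ * ∑ i ∈ I, ∫ x, f x ∂(m i) := by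
  rw [average, integral_smul_measure, integral_finsetSum_measure fun i _ => hf i]
  simp

/-- The Shannon entropy is a concave function of the measure. -/
theorem average_fnEntropy_le {ι : Type*} [Fintype ι] {I : Finset κ} (hI : I.Nonempty)
    {m : κ → Measure Ω} (hm : ∀ i, IsProbabilityMeasure (m i)) (F : Ω → ι) :
    (I.card : ℝ)⁻¹ * ∑ i ∈ I, fnEntropy (m i) F ≤ fnEntropy (average I m) F := by
  have hc : (0 : ℝ) < I.card := by exact_mod_cast hI.card_pos
  simp only [fnEntropy]
  rw [Finset.sum_comm, Finset.mul_sum]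
  refine Finset.sum_le_sum fun a _ => ?_
  rw [average_real_apply I hm, Finset.mul_sum, Finset.mul_sum]
  refine Real.concaveOn_negMulLog.le_map_sum (w := fun _ => (I.card : ℝ)⁻¹)
    (p := fun i => (m i).real (F ⁻¹' {a})) (fun _ _ => by positivity) ?_
    fun _ _ => measureReal_nonneg
  rw [Finset.sum_const, nsmul_eq_mul, mul_inv_cancel₀ hc.ne']

/-- The entropy of an injective coding of a uniform measure on a finite set. -/
theorem log_card_le_fnEntropy_average_dirac {ι : Type*} [Fintype ι] [MeasurableSpace ι]
    [MeasurableSingletonClass ι] {E : Finset Ω} (hE : E.Nonempty) {F : Ω → ι} (hF : Measurable F)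
    (hinj : InjOn F E) : Real.log E.card ≤ fnEntropy (average E Measure.dirac) F := by
  classical
  have hc : (0 : ℝ) < E.card := by exact_mod_cast hE.card_pos
  have hprob := isProbabilityMeasure_average hE fun z : Ω =>
    Measure.dirac.isProbabilityMeasure (x := z)
  have h1 : ∀ z ∈ E, (average E Measure.dirac).real (F ⁻¹' {F z}) = (E.card : ℝ)⁻¹ := by
    intro z hz
    rw [average_real_apply E (fun z => Measure.dirac.isProbabilityMeasure (x := z)),
      Finset.sum_eq_single_of_mem z hz]
    · simp [Measure.real, Measure.dirac_apply' _ (hF (measurableSet_singleton _))]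
    · intro z' hz' hne
      have : F z' ≠ F z := fun h => hne (hinj hz' hz h)
      simp [Measure.real, Measure.dirac_apply' _ (hF (measurableSet_singleton _)), this]
  calc Real.log E.card = ∑ z ∈ E, Real.negMulLog (E.card : ℝ)⁻¹ := by
        rw [Finset.sum_const, nsmul_eq_mul, Real.negMulLog, Real.log_inv]
        field_simp
    _ = ∑ z ∈ E, Real.negMulLog ((average E Measure.dirac).real (F ⁻¹' {F z})) :=
        Finset.sum_congr rfl fun z hz => by rw [h1 z hz]
    _ = ∑ a ∈ E.image F, Real.negMulLog ((average E Measure.dirac).real (F ⁻¹' {a})) :=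
        (Finset.sum_image (f := fun a =>
          Real.negMulLog ((average E Measure.dirac).real (F ⁻¹' {a}))) hinj).symm
    _ ≤ fnEntropy (average E Measure.dirac) F :=
        Finset.sum_le_sum_of_subset_of_nonneg (Finset.subset_univ _) fun _ _ _ =>
          Real.negMulLog_nonneg measureReal_nonneg measureReal_le_one

end Average

section Limit

variable {Ω : Type*} [TopologicalSpace Ω]

theorem notMem_frontier_of_eventually_eq {ι : Type*} {F : Ω → ι} {z : Ω}
    (h : ∀ᶠ z' in 𝓝 z, F z' = F z) (w : ι) : z ∉ frontier (F ⁻¹' {w}) := by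
  rw [frontier_eq_closure_inter_closure]
  rintro ⟨h1, h2⟩
  rw [mem_closure_iff_frequently] at h1 h2
  obtain ⟨a, ha, ha'⟩ := (h1.and_eventually h).exists
  obtain ⟨b, hb, hb'⟩ := (h2.and_eventually h).exists
  exact hb (hb'.trans (ha'.symm.trans ha))

variable [MeasurableSpace Ω]

/-- Invariance carries the null exceptional set to all times. Fibres of the itinerary thus have null
frontiers, and their masses pass to weak limits. -/
theorem eventually_itinerary_eq {ι : Type*} {σ : Ω → Ω} (hσ : Continuous σ) {ν : Measure Ω}
    (hν : MeasurePreserving σ ν ν) {p : Ω → ι} (hp : ∀ᵐ z ∂ν, ∀ᶠ z' in 𝓝 z, p z' = p z) (q : ℕ) :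
    ∀ᵐ z ∂ν, ∀ᶠ z' in 𝓝 z, itinerary σ p q z' = itinerary σ p q z := by
  have h : ∀ᵐ z ∂ν, ∀ j : ℕ, ∀ᶠ z' in 𝓝 (σ^[j] z), p z' = p (σ^[j] z) :=
    ae_all_iff.2 fun j => (hν.iterate j).quasiMeasurePreserving.ae hp
  filter_upwards [h] with z hz
  simp only [funext_iff]
  exact eventually_all.2 fun j => ((hσ.iterate j).tendsto z).eventually (hz j)

/-- Misiurewicz's argument: ν is a limit of time averages of uniform measures on `E n`. The coding
is quantified after ν, so that it can be chosen with cell boundaries that are null for ν. -/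
theorem exists_invariant_limit [CompactSpace Ω] [TopologicalSpace.MetrizableSpace Ω] [BorelSpace Ω]
    {σ : Ω → Ω} (hσ : Continuous σ) (E : ℕ → Finset Ω)
    (hE : ∀ n, (E n).Nonempty) {a : ℝ} (ha : ∃ᶠ n : ℕ in atTop, a * n ≤ Real.log (E n).card) :
    ∃ ν : ProbabilityMeasure Ω, MeasurePreserving σ (ν : Measure Ω) ν ∧
      (∀ G : Set Ω, IsOpen G → (∀ n, ∀ z ∈ E n, ∀ i, σ^[i] z ∉ G) → (ν : Measure Ω) G = 0) ∧
      ∀ (N : ℕ) (p : Ω → Fin N), Measurable p → (∀ᵐ z ∂(ν : Measure Ω), ∀ᶠ z' in 𝓝 z, p z' = p z) →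
        (∀ n, InjOn (itinerary σ p n) (E n)) →
        ∀ q : ℕ, a * q ≤ fnEntropy (ν : Measure Ω) (itinerary σ p q) := by
  have hi := fun i => (hσ.iterate i).measurable
  set s : ℕ → Measure Ω := fun n => average (E n) Measure.dirac with hs
  have hsp : ∀ n, IsProbabilityMeasure (s n) := fun n =>
    isProbabilityMeasure_average (hE n) fun z => Measure.dirac.isProbabilityMeasure (x := z)
  have hmp : ∀ n i, IsProbabilityMeasure ((s n).map σ^[i]) := fun n i =>
    Measure.isProbabilityMeasure_map (hi i).aemeasurable
  have hne : ∀ n : ℕ, (Finset.range (n + 1)).Nonempty := fun n => Finset.nonempty_range_add_one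
  set P : ℕ → ProbabilityMeasure Ω := fun n =>
    ⟨average (Finset.range (n + 1)) fun i => (s n).map σ^[i],
      isProbabilityMeasure_average (hne n) (hmp n)⟩ with hP
  have hPm : ∀ n, (P n : Measure Ω) = average (Finset.range (n + 1)) fun i => (s n).map σ^[i] :=
    fun _ => rfl
  -- An ultrafilter concentrated on the indices with the growth bound replaces the choice of a
  -- subsequence.
  have hneBot : NeBot (atTop ⊓ 𝓟 {n : ℕ | a * n ≤ Real.log (E n).card}) :=
    frequently_mem_iff_neBot.1 ha
  set U : Ultrafilter ℕ := Ultrafilter.of (atTop ⊓ 𝓟 {n : ℕ | a * n ≤ Real.log (E n).card})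
  have hU : (U : Filter ℕ) ≤ atTop ⊓ 𝓟 {n : ℕ | a * n ≤ Real.log (E n).card} := Ultrafilter.of_le _
  have hUtop : (U : Filter ℕ) ≤ atTop := hU.trans inf_le_left
  have hUa : ∀ᶠ n in (U : Filter ℕ), a * n ≤ Real.log (E n).card :=
    (hU.trans inf_le_right) (mem_principal_self _)
  obtain ⟨ν, -, hν⟩ := isCompact_univ.ultrafilter_le_nhds (U.map P) (by simp)
  have hlim : Tendsto P U (𝓝 ν) := hν
  have hinv : MeasurePreserving σ (ν : Measure Ω) ν := by
    refine ⟨hσ.measurable, ?_⟩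
    have := Measure.isProbabilityMeasure_map (μ := (ν : Measure Ω)) hσ.measurable.aemeasurable
    refine ext_of_forall_integral_eq_of_IsFiniteMeasure fun f => ?_
    rw [integral_map hσ.measurable.aemeasurable f.continuous.aestronglyMeasurable]
    set g := f.compContinuous ⟨σ, hσ⟩ with hg
    have h1 := ProbabilityMeasure.tendsto_iff_forall_integral_tendsto.1 hlim f
    have h2 := ProbabilityMeasure.tendsto_iff_forall_integral_tendsto.1 hlim g
    refine tendsto_nhds_unique h2 ?_
    have hint : ∀ (h : BoundedContinuousFunction Ω ℝ) n, ∫ x, h x ∂(P n : Measure Ω) =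
        ((n : ℝ) + 1)⁻¹ * ∑ i ∈ Finset.range (n + 1), ∫ x, h (σ^[i] x) ∂(s n) := by
      intro h n
      rw [hPm, integral_average _ fun i => h.integrable _, Finset.card_range]
      push_cast
      refine congrArg _ (Finset.sum_congr rfl fun i _ => ?_)
      exact integral_map (hi i).aemeasurable h.continuous.aestronglyMeasurable
    -- The time averages telescope, leaving a boundary term of order 1 / n.
    have hdiff : ∀ n, ∫ x, g x ∂(P n : Measure Ω) - ∫ x, f x ∂(P n : Measure Ω) =
        ((n : ℝ) + 1)⁻¹ * (∫ x, f (σ^[n + 1] x) ∂(s n) - ∫ x, f x ∂(s n)) := by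
      intro n
      have e : ∀ i x, g (σ^[i] x) = f (σ^[i + 1] x) := fun i x => by
        rw [Function.iterate_succ_apply']; rfl
      rw [hint, hint, ← mul_sub, ← Finset.sum_sub_distrib]
      simp only [e]
      rw [Finset.sum_range_sub (fun i => ∫ x, f (σ^[i] x) ∂(s n))]
      rfl
    have hb : ∀ n i, |∫ x, f (σ^[i] x) ∂(s n)| ≤ ‖f‖ := fun n i => by
      have := norm_integral_le_of_norm_le_const (μ := s n) (f := fun x => f (σ^[i] x)) (C := ‖f‖)
        (Eventually.of_forall fun x => f.norm_coe_le_norm _)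
      simpa using this
    have hd0 : Tendsto (fun n => ∫ x, g x ∂(P n : Measure Ω) - ∫ x, f x ∂(P n : Measure Ω)) atTop
        (𝓝 0) := by
      refine squeeze_zero_norm (a := fun n : ℕ => 2 * ‖f‖ * (1 / ((n : ℝ) + 1))) (fun n => ?_) ?_
      · rw [hdiff, norm_mul, Real.norm_eq_abs, Real.norm_eq_abs, abs_of_pos (by positivity),
          mul_comm, one_div]
        refine mul_le_mul_of_nonneg_right ?_ (by positivity)
        refine (abs_sub _ _).trans ?_
        have hb0 := hb n 0
        simp only [Function.iterate_zero, id_eq] at hb0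
        linarith [hb n (n + 1)]
      · simpa using tendsto_one_div_add_atTop_nhds_zero_nat.const_mul (2 * ‖f‖)
    simpa using (hd0.mono_left hUtop).add h1
  refine ⟨ν, hinv, fun G hG hEG => ?_, fun N p hp hploc hpinj q => ?_⟩
  · have h1 := ProbabilityMeasure.le_liminf_measure_open_of_tendsto hlim hG
    have h2 : ∀ n, (P n : Measure Ω) G = 0 := by
      intro n
      rw [hPm, average, Measure.smul_apply, Measure.coe_finsetSum, Finset.sum_apply,
        Finset.sum_eq_zero, smul_zero]
      intro i _
      rw [Measure.map_apply (hi i) hG.measurableSet, hs]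
      simp only [average, Measure.smul_apply, Measure.coe_finsetSum, Finset.sum_apply]
      rw [Finset.sum_eq_zero, smul_zero]
      intro z hz
      rw [Measure.dirac_apply' _ (hi i hG.measurableSet)]
      exact indicator_of_notMem (s := σ^[i] ⁻¹' G) (hEG n z hz i) _
    simpa [h2] using h1
  rcases q.eq_zero_or_pos with rfl | hq
  · simpa using fnEntropy_nonneg (ν : Measure Ω) (itinerary σ p 0)
  have hitin := fun n => measurable_itinerary hσ.measurable hp n
  have hH : Tendsto (fun n => fnEntropy (P n : Measure Ω) (itinerary σ p q)) U
      (𝓝 (fnEntropy (ν : Measure Ω) (itinerary σ p q))) := by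
    refine tendsto_finsetSum _ fun w _ => (Real.continuous_negMulLog.tendsto _).comp ?_
    have hfr : (ν : Measure Ω) (frontier (itinerary σ p q ⁻¹' {w})) = 0 := by
      refine measure_mono_null (fun z hz => ?_) (eventually_itinerary_eq hσ hinv hploc q)
      exact fun h => notMem_frontier_of_eventually_eq h w hz
    exact (ENNReal.tendsto_toReal (measure_ne_top _ _)).comp
      (ProbabilityMeasure.tendsto_measure_of_null_frontier_of_tendsto' hlim hfr)
  set C := 2 * (q : ℝ) ^ 2 * Real.log (Fintype.card (Fin N)) with hC
  -- Injectivity gives log |E n| as a lower bound for the entropy of long itineraries; windows of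
  -- length q and concavity transfer it to `P n`. Averages run over n + 1 times, hence the
  -- correction of order 1 / (n + 1).
  have key : ∀ n, a * n ≤ Real.log (E n).card →
      a * q - (a * q + C) * (1 / ((n : ℝ) + 1)) ≤
        fnEntropy (P n : Measure Ω) (itinerary σ p q) := by
    intro n hn
    have h1 := mul_fnEntropy_itinerary_le hσ.measurable hp (s n) hq (n + 1)
    have h2 := log_card_le_fnEntropy_average_dirac (hE n) (hitin (n + 1)) 
      fun z hz z' hz' h => hpinj n hz hz' (itinerary_of_le n.le_succ h)
    have h3 := average_fnEntropy_le (hne n) (hmp n) (itinerary σ p q)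
    rw [← hPm, Finset.card_range] at h3
    have h4 : ∑ i ∈ Finset.range (n + 1), fnEntropy ((s n).map σ^[i]) (itinerary σ p q) =
        ∑ i ∈ Finset.range (n + 1), fnEntropy (s n) (itinerary σ p q ∘ σ^[i]) :=
      Finset.sum_congr rfl fun i _ => fnEntropy_map (hi i) (hitin q)
    rw [h4, inv_mul_le_iff₀ (by positivity)] at h3
    have h5 := mul_le_mul_of_nonneg_left (hn.trans h2) (Nat.cast_nonneg (α := ℝ) q)
    have hn1 : (0 : ℝ) < n + 1 := by positivity
    push_cast at h3
    rw [sub_le_comm, mul_one_div, le_div_iff₀ hn1]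
    nlinarith
  have hlimL : Tendsto (fun n : ℕ => a * q - (a * q + C) * (1 / ((n : ℝ) + 1))) atTop
      (𝓝 (a * q - (a * q + C) * 0)) :=
    tendsto_const_nhds.sub (tendsto_one_div_add_atTop_nhds_zero_nat.const_mul _)
  rw [mul_zero, sub_zero] at hlimL
  exact le_of_tendsto_of_tendsto (hlimL.mono_left hUtop) hH (hUa.mono key)

end Limit

/-! ### Shift-invariant measures on orbit spaces -/

/-- Finitely many balls of radius below ε / 2 with null frontiers cover Y, and the code records
which of them contain the point. Equal codes share a ball, and the code is locally constant off the
frontiers. -/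
theorem exists_fine_coding {Y : Type*} [MetricSpace Y] [CompactSpace Y] [MeasurableSpace Y]
    [BorelSpace Y] (m : Measure Y) [IsFiniteMeasure m] {ε : ℝ} (hε : 0 < ε) :
    ∃ (N : ℕ) (p : Y → Fin N), Measurable p ∧ (∀ x y, p x = p y → dist x y < ε) ∧
      ∀ᵐ y ∂m, ∀ᶠ y' in 𝓝 y, p y' = p y := by
  classical
  have h : ∀ y : Y, ∃ r ∈ Ioo 0 (ε / 2), m (frontier (Metric.ball y r)) = 0 := fun y => by
    simpa only [Metric.thickening_singleton] using
      exists_null_frontier_thickening m {y} (half_pos hε)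
  choose r hr hfr using h
  obtain ⟨t, ht⟩ := CompactSpace.elim_nhds_subcover (fun y => Metric.ball y (r y))
    fun y => Metric.ball_mem_nhds y (hr y).1
  set s : Y → (t → Bool) := fun y i => decide (y ∈ Metric.ball (i : Y) (r i)) with hs
  set e := Fintype.equivFin (t → Bool)
  have hsm : Measurable s := measurable_pi_lambda _ fun i =>
    measurable_to_bool <| by
      have : (fun y => s y i) ⁻¹' {true} = Metric.ball (i : Y) (r i) := by ext y; simp [hs]
      rw [this]
      exact Metric.isOpen_ball.measurableSet
  refine ⟨_, fun y => e (s y), (measurable_of_finite e).comp hsm, fun x y hxy => ?_, ?_⟩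
  · have hx : x ∈ ⋃ y ∈ t, Metric.ball y (r y) := by rw [ht]; trivial
    obtain ⟨i, hi, hxi⟩ := mem_iUnion₂.1 hx
    have h1 := congrFun (e.injective hxy) ⟨i, hi⟩
    have hyi : y ∈ Metric.ball i (r i) := by
      simpa [hs, Metric.mem_ball.1 hxi] using h1
    have := dist_triangle_right x y i
    rw [Metric.mem_ball] at hxi hyi
    linarith [(hr i).2]
  · have hae : ∀ᵐ y ∂m, ∀ i : t, y ∉ frontier (Metric.ball (i : Y) (r i)) :=
      ae_all_iff.2 fun i => measure_eq_zero_iff_ae_notMem.1 (hfr i)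
    filter_upwards [hae] with y hy
    have h1 : ∀ i : t, ∀ᶠ y' in 𝓝 y, s y' i = s y i := by
      intro i
      have hyi := hy i
      rw [frontier_eq_closure_inter_closure, mem_inter_iff, not_and_or, ← mem_compl_iff,
        ← mem_compl_iff, ← interior_compl, ← interior_compl, compl_compl] at hyi
      rcases hyi with hyi | hyi
      · filter_upwards [mem_interior_iff_mem_nhds.1 hyi] with y' hy'
        have := interior_subset hyi
        simp only [hs, decide_eq_decide]
        exact iff_of_false hy' this
      · filter_upwards [mem_interior_iff_mem_nhds.1 hyi] with y' hy'
        have := interior_subset hyi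
        simp only [hs, decide_eq_decide]
        exact iff_of_true hy' this
    filter_upwards [eventually_all.2 h1] with y' hy'
    exact congrArg e (funext hy')

theorem isFinitePartition_range_fiber {X ι : Type*} [MeasurableSpace X] [Finite ι]
    [MeasurableSpace ι] [MeasurableSingletonClass ι] {c : X → ι} (hc : Measurable c) :
    IsFinitePartition (range fun i => c ⁻¹' {i}) where
  finite := finite_range _
  measurableSet := by
    rintro _ ⟨i, rfl⟩
    exact hc (measurableSet_singleton i)
  isCover := eq_univ_of_forall fun x => ⟨_, ⟨c x, rfl⟩, rfl⟩
  disjoint := by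
    rintro _ ⟨i, rfl⟩ _ ⟨j, rfl⟩ hij
    refine disjoint_left.2 fun x hi hj => hij ?_
    rw [mem_preimage, mem_singleton_iff] at hi hj
    rw [← hi, ← hj]

/-- The shift on sequences. -/
def shift {Y : Type*} (z : ℕ → Y) : ℕ → Y := fun i => z (i + 1)

theorem shift_iterate_apply {Y : Type*} (z : ℕ → Y) (j i : ℕ) : shift^[j] z i = z (i + j) := by
  induction j generalizing z with
  | zero => rfl
  | succ j ih => rw [Function.iterate_succ_apply, ih, shift, add_assoc]

theorem continuous_shift {Y : Type*} [TopologicalSpace Y] : Continuous (shift (Y := Y)) :=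
  continuous_pi fun i => continuous_apply (i + 1)

section Orbit

variable {X Y : Type*}

/-- The orbit of a point, seen in an ambient space. -/
def orbitSeq (e : X → Y) (T : X → X) (x : X) : ℕ → Y := fun j => e (T^[j] x)

theorem shift_iterate_orbitSeq (e : X → Y) (T : X → X) (x : X) (j : ℕ) :
    shift^[j] (orbitSeq e T x) = orbitSeq e T (T^[j] x) := by
  funext i
  rw [shift_iterate_apply, orbitSeq, orbitSeq, Function.iterate_add_apply]

variable [TopologicalSpace X] [TopologicalSpace Y]

/-- The complement of a closed graph is open, the open map e × id carries it to an open set of Y ×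
Y, and the first two coordinates pull it back. -/
theorem isOpen_setOf_not_orbit [T2Space Y] {e : X → Y} (he : IsOpenEmbedding e) {T : X → X}
    (hT : Continuous T) : IsOpen {z : ℕ → Y | ∃ x, e x = z 0 ∧ e (T x) ≠ z 1} := by
  have h1 : IsOpen {w : X × Y | e (T w.1) ≠ w.2} :=
    (isClosed_eq ((he.continuous.comp hT).comp continuous_fst) continuous_snd).isOpen_compl
  have h2 := (he.isOpenMap.prodMap (IsOpenMap.id (X := Y))) _ h1
  have h3 : Continuous fun z : ℕ → Y => (z 0, z 1) := by fun_prop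
  convert h2.preimage h3 using 1
  ext z
  simp only [mem_ofPred_eq, mem_preimage, mem_image, Prod.exists, Prod.map_apply, id_eq,
    Prod.mk_inj]
  exact ⟨fun ⟨x, hx, hne⟩ => ⟨x, z 1, hne, hx, rfl⟩, fun ⟨x, y, hne, hx, hy⟩ => ⟨x, hx, hy ▸ hne⟩⟩

variable [MeasurableSpace Y] [BorelSpace Y]

/-- A shift-invariant measure without mass on the sequences which leave the graph of `T` is
carried by orbits of `T` and by sequences which avoid `X`. -/
theorem ae_eq_orbitSeq {e : X → Y} (he : IsOpenEmbedding e) {T : X → X} {ν : Measure (ℕ → Y)}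
    [IsFiniteMeasure ν] (hν : MeasurePreserving shift ν ν)
    (h0 : ν {z : ℕ → Y | ∃ x, e x = z 0 ∧ e (T x) ≠ z 1} = 0) :
    ∀ᵐ z ∂ν, (∃ x, z = orbitSeq e T x) ∨ ∀ j, z j ∉ range e := by
  set R : Set (ℕ → Y) := {z | z 0 ∈ range e} with hR
  have hRm : MeasurableSet R := measurable_pi_apply 0 he.isOpen_range.measurableSet
  have hG : ∀ᵐ z ∂ν, ∀ j, ∀ x, e x = z j → e (T x) = z (j + 1) := by
    refine ae_all_iff.2 fun j => ?_
    have := (hν.iterate j).quasiMeasurePreserving.ae (measure_eq_zero_iff_ae_notMem.1 h0)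
    filter_upwards [this] with z hz x hx
    by_contra hne
    refine hz ⟨x, ?_, ?_⟩ <;> rw [shift_iterate_apply]
    · rwa [zero_add]
    · rwa [add_comm]
  -- A sequence in X stays in X. Both sets have the same finite measure, so the inclusion is an
  -- almost everywhere equality: almost no sequence enters X from outside.
  have hsub : R ≤ᵐ[ν] shift ⁻¹' R := by
    filter_upwards [hG] with z hz hzR
    obtain ⟨x, hx⟩ := hzR
    exact ⟨T x, hz 0 x hx⟩
  have heq : R =ᵐ[ν] shift ⁻¹' R :=
    ae_eq_of_ae_subset_of_measure_ge hsub (hν.measure_preimage hRm.nullMeasurableSet).le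
      hRm.nullMeasurableSet (measure_ne_top _ _)
  have hj : ∀ᵐ z ∂ν, ∀ j, z j ∈ range e ↔ z (j + 1) ∈ range e := by
    refine ae_all_iff.2 fun j => ?_
    have := (hν.iterate j).quasiMeasurePreserving.ae heq.mem_iff
    filter_upwards [this] with z hz
    simp only [hR, mem_preimage, mem_ofPred_eq, shift, shift_iterate_apply] at hz
    rwa [zero_add, zero_add, add_comm 1] at hz
  filter_upwards [hG, hj] with z hz hzj
  by_cases h : z 0 ∈ range e
  · obtain ⟨x, hx⟩ := h
    refine .inl ⟨x, funext fun j => ?_⟩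
    induction j with
    | zero => exact hx.symm
    | succ j ih =>
      rw [orbitSeq, Function.iterate_succ_apply']
      exact (hz j _ ih.symm).symm
  · refine .inr fun j => ?_
    induction j with
    | zero => exact h
    | succ j ih => exact fun h' => ih ((hzj j).2 h')

end Orbit

/-! ### Metrics of the one-point compactification -/

section OnePoint

/-- A countable basis of X and the complements of a compact exhaustion form a countable basis;
Urysohn's theorem then applies. -/
theorem metrizableSpace_onePoint (X : Type*) [TopologicalSpace X]
    [TopologicalSpace.MetrizableSpace X] [LocallyCompactSpace X]
    [TopologicalSpace.SeparableSpace X] : TopologicalSpace.MetrizableSpace (OnePoint X) := by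
  let _ := TopologicalSpace.metrizableSpaceMetric X
  have : SecondCountableTopology X := UniformSpace.secondCountable_of_separable X
  set K := CompactExhaustion.choice X
  set B : Set (Set (OnePoint X)) :=
    (fun s => ((↑) : X → OnePoint X) '' s) '' TopologicalSpace.countableBasis X ∪
      range fun n => (((↑) : X → OnePoint X) '' K n)ᶜ
  have hB : TopologicalSpace.IsTopologicalBasis B := by
    refine TopologicalSpace.isTopologicalBasis_of_isOpen_of_nhds ?_ ?_
    · rintro _ (⟨s, hs, rfl⟩ | ⟨n, rfl⟩)
      · exact OnePoint.isOpen_image_coe.2 (TopologicalSpace.isOpen_of_mem_countableBasis hs)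
      · exact OnePoint.isOpen_compl_image_coe.2 ⟨(K.isCompact n).isClosed, K.isCompact n⟩
    · intro y U hy hU
      induction y using OnePoint.rec with
      | infty =>
        obtain ⟨n, hn⟩ := K.exists_superset_of_isCompact ((OnePoint.isOpen_def.1 hU).1 hy)
        refine ⟨_, .inr ⟨n, rfl⟩, by simp, fun z hz => ?_⟩
        induction z using OnePoint.rec with
        | infty => exact hy
        | coe x => exact by_contra fun hx => hz ⟨x, hn hx, rfl⟩
      | coe x =>
        obtain ⟨s, hs, hxs, hsU⟩ := (TopologicalSpace.isBasis_countableBasis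
          X).exists_subset_of_mem_open (show x ∈ ((↑) : X → OnePoint X) ⁻¹' U from hy) (hU.preimage OnePoint.continuous_coe)
        exact ⟨_, .inl ⟨s, hs, rfl⟩, ⟨x, hxs, rfl⟩, image_subset_iff.2 hsU⟩
  have : SecondCountableTopology (OnePoint X) := hB.secondCountableTopology
    (((TopologicalSpace.countable_countableBasis X).image _).union (countable_range _))
  exact TopologicalSpace.metrizableSpace_of_t3_secondCountable _

theorem isCompatibleMetric_dist_comp {X Y : Type*} [TopologicalSpace X] [MetricSpace Y] {e : X → Y}
    (he : IsEmbedding e) : IsCompatibleMetric fun x y => dist (e x) (e y) where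
  dist_self _ := dist_self _
  eq_of_dist_eq_zero _ _ h := he.injective (eq_of_dist_eq_zero h)
  dist_comm _ _ := dist_comm _ _
  dist_triangle _ _ _ := dist_triangle _ _ _
  isOpen_iff s := by
    rw [isOpen_iff_mem_nhds]
    refine forall₂_congr fun x _ => ?_
    rw [he.isInducing.nhds_eq_comap, (Metric.nhds_basis_ball.comap e).mem_iff]
    simp only [preimage, Metric.mem_ball, dist_comm]

/-- Traces of balls of radius ε / 2 cover X by sets whose mutual distances are below ε, and the ball
around ∞ provides the member with compact complement. Every member of the iterated cover lies in a
`d_n`-ball about any of its points. -/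
theorem dEntropy_le_topologicalEntropy {X : Type*} [TopologicalSpace X] {d : X → X → ℝ}
    (hd : ExtendsToOnePoint d) (T : X → X) : dEntropy d T ≤ topologicalEntropy T := by
  obtain ⟨D, hD, hDd⟩ := hd
  let _ : MetricSpace (OnePoint X) := MetricSpace.ofDistTopology D hD.dist_self hD.dist_comm
    hD.dist_triangle hD.isOpen_iff hD.eq_of_dist_eq_zero
  have hdist : ∀ x y : X, dist (x : OnePoint X) (y : OnePoint X) = d x y := hDd
  refine iSup₂_le fun ε hε => ?_
  set 𝒜 : Set (Set X) := {A | IsOpen A ∧ ∀ x ∈ A, ∀ y ∈ A, d x y < ε} with h𝒜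
  have hball : ∀ y : OnePoint X, ((↑) : X → OnePoint X) ⁻¹' Metric.ball y (ε / 2) ∈ 𝒜 := by
    refine fun y => ⟨Metric.isOpen_ball.preimage OnePoint.continuous_coe, fun a ha b hb => ?_⟩
    rw [← hdist]
    rw [mem_preimage, Metric.mem_ball] at ha hb
    linarith [dist_triangle_right (a : OnePoint X) b y]
  have hadm : IsAdmissible 𝒜 := by
    refine ⟨fun A hA => hA.1, eq_univ_of_forall fun x => ⟨_, hball x, ?_⟩,
      _, hball OnePoint.infty, ?_⟩
    · exact Metric.mem_ball_self (half_pos hε)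
    · exact (OnePoint.isOpen_def.1 Metric.isOpen_ball).1 (Metric.mem_ball_self (half_pos hε))
  refine le_trans ?_ (le_iSup₂ (f := fun 𝒜 (_ : IsAdmissible 𝒜) => entropyOfCover T 𝒜) 𝒜 hadm)
  refine limsup_le_limsup (Eventually.of_forall fun n => ENNReal.div_le_div_right ?_ _)
  refine coverEntropy_mono Subset.rfl fun S hS ⟨x, hx⟩ => ⟨_, ⟨x, rfl⟩, fun y hy => ?_⟩
  refine (iterDist_lt_iff hε).2 fun j hj => ?_
  obtain ⟨A, hA, hSA⟩ := exists_subset_preimage_of_mem_iterCover hS hj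
  exact hA.2 _ (hSA hx.2) _ (hSA hy.2)

end OnePoint

/-! ### Maximal separated sets of orbits -/

section Separated

variable {X Y : Type*} [MetricSpace Y]

/-- Distinct points of `E` are `ε`-separated by their orbits of length `n`. -/
def IsOrbitSeparated (e : X → Y) (T : X → X) (ε : ℝ) (n : ℕ) (E : Finset X) : Prop :=
  ∀ x ∈ E, ∀ y ∈ E, (∀ j < n, dist (e (T^[j] x)) (e (T^[j] y)) < ε) → x = y

theorem exists_maximal_isOrbitSeparated [CompactSpace Y] (e : X → Y) (T : X → X) {ε : ℝ}
    (hε : 0 < ε) (n : ℕ) : ∃ E : Finset X, IsOrbitSeparated e T ε n E ∧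
      ∀ x, ∃ y ∈ E, ∀ j < n, dist (e (T^[j] x)) (e (T^[j] y)) < ε := by
  classical
  borelize Y
  -- Only the fineness of the coding is used, to bound the size of separated sets, so the zero
  -- measure suffices.
  obtain ⟨N, p, -, hp, -⟩ := exists_fine_coding (0 : Measure Y) hε
  have hbdd : ∀ E, IsOrbitSeparated e T ε n E → E.card ≤ Fintype.card (Fin n → Fin N) := by
    intro E hE
    refine Finset.card_le_card_of_injOn (itinerary T (p ∘ e) n) (fun _ _ => Finset.mem_univ _) ?_
    intro x hx y hy h
    rw [itinerary_eq_iff] at h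
    exact hE x hx y hy fun j hj => hp _ _ (h j hj)
  obtain ⟨k, ⟨E, hE, hk⟩, hmax⟩ : ∃ k, (∃ E, IsOrbitSeparated e T ε n E ∧ E.card = k) ∧
      ∀ k', (∃ E, IsOrbitSeparated e T ε n E ∧ E.card = k') → k' ≤ k := by
    have hne : {k | ∃ E, IsOrbitSeparated e T ε n E ∧ E.card = k}.Nonempty :=
      ⟨0, ∅, by simp [IsOrbitSeparated], rfl⟩
    have hb : BddAbove {k | ∃ E, IsOrbitSeparated e T ε n E ∧ E.card = k} :=
      ⟨_, by rintro _ ⟨E, hE, rfl⟩; exact hbdd E hE⟩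
    exact ⟨_, Nat.sSup_mem hne hb, fun k' hk' => le_csSup hb hk'⟩
  refine ⟨E, hE, fun x => by_contra fun hx => ?_⟩
  push Not at hx
  have hxE : x ∉ E := fun h => by
    obtain ⟨j, -, hj⟩ := hx x h
    rw [dist_self] at hj
    linarith
  have := hmax _ ⟨insert x E, ?_, rfl⟩
  · rw [Finset.card_insert_of_notMem hxE] at this
    omega
  · intro a ha b hb h
    rcases Finset.mem_insert.1 ha with rfl | ha' <;>
      rcases Finset.mem_insert.1 hb with rfl | hb'
    · rfl
    · obtain ⟨j, hj, hle⟩ := hx b hb'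
      exact absurd (h j hj) hle.not_gt
    · obtain ⟨j, hj, hle⟩ := hx a ha'
      rw [dist_comm] at hle
      exact absurd (h j hj) hle.not_gt
    · exact hE a ha' b hb' h

/-- Each point of E selects the member of the iterated cover that follows its orbit; since E is
spanning, these members cover X. -/
theorem coverEntropy_iterCover_le {e : X → Y} {T : X → X} {𝒜 : Set (Set X)} {ε : ℝ} {n : ℕ}
    (h𝒜 : ∀ x, ∃ A ∈ 𝒜, ∀ y, dist (e y) (e x) < ε → y ∈ A) (hε : 0 < ε) {E : Finset X}
    (hE : ∀ x, ∃ y ∈ E, ∀ j < n, dist (e (T^[j] x)) (e (T^[j] y)) < ε) :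
    coverEntropy univ (iterCover T 𝒜 n) ≤ ENNReal.ofReal (Real.log E.card) := by
  choose A hA hAε using h𝒜
  refine coverEntropy_le_ofReal_log E (fun x => {y | ∀ j < n, T^[j] y ∈ A (T^[j] x)})
    (fun x _ => mem_iterCover (A := fun j => A (T^[j] x)) (fun j => hA _) (x := x)
      (fun j => hAε _ _ (by simpa using hε)) n) fun x _ => ?_
  obtain ⟨y, hy, hxy⟩ := hE x
  exact ⟨y, hy, fun j hj => hAε _ _ (hxy j hj)⟩

end Separated

/-! ### From the orbit space back to the phase space -/

section Restrict

variable {X Y : Type*} [TopologicalSpace X] [MeasurableSpace X] [BorelSpace X] [TopologicalSpace Y]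
  [MeasurableSpace Y] [BorelSpace Y]

/-- The part carried by orbits of `T` of a shift-invariant measure, normalized and seen as a measure
on the phase space. -/
theorem exists_invariant_of_shift_invariant {e : X → Y} (he : IsOpenEmbedding e)
    {pt : Y} (hpt : ∀ y ∉ range e, y = pt) {T : X → X} (hT : Continuous T)
    {ν : ProbabilityMeasure (ℕ → Y)} (hν : MeasurePreserving shift (ν : Measure (ℕ → Y)) ν)
    (h0 : (ν : Measure (ℕ → Y)) {z : ℕ → Y | ∃ x, e x = z 0 ∧ e (T x) ≠ z 1} = 0)
    {ι : Type*} [Fintype ι] [MeasurableSpace ι] [MeasurableSingletonClass ι] {p : Y → ι}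
    (hp : Measurable p) {a : ℝ} (ha : 0 < a)
    (hle : ∀ q : ℕ,
      a * q ≤ fnEntropy (ν : Measure (ℕ → Y)) (itinerary shift (fun z => p (z 0)) q)) :
    ∃ μ : ProbabilityMeasure X, MeasurePreserving T (μ : Measure X) μ ∧
      ∀ q : ℕ, a * q ≤ fnEntropy (μ : Measure X) (itinerary T (p ∘ e) q) + 2 := by
  classical
  have hme : MeasurableEmbedding e := he.measurableEmbedding
  have hae := ae_eq_orbitSeq he hν h0
  set R : Set (ℕ → Y) := {z | z 0 ∈ range e} with hR
  have hRm : MeasurableSet R := measurable_pi_apply 0 he.isOpen_range.measurableSet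
  set μ' : Measure X := ((ν : Measure (ℕ → Y)).map fun z => z 0).comap e with hμ'
  have hμ'A : ∀ A, MeasurableSet A → μ' A = (ν : Measure (ℕ → Y)) {z | z 0 ∈ e '' A} := by
    intro A hA
    rw [hμ', hme.comap_apply, Measure.map_apply (measurable_pi_apply 0)
      (hme.measurableSet_image' hA)]
    rfl
  have hμ'R : μ' univ = (ν : Measure (ℕ → Y)) R := by
    rw [hμ'A _ MeasurableSet.univ, image_univ]
  have hfin : IsFiniteMeasure μ' := ⟨by rw [hμ'R]; exact measure_lt_top _ _⟩
  set F : ∀ q, (ℕ → Y) → Fin q → ι := fun q => itinerary shift (fun z => p (z 0)) q with hF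
  have horb : ∀ q x, F q (orbitSeq e T x) = itinerary T (p ∘ e) q x := by
    intro q x
    funext j
    simp only [hF, itinerary, shift_iterate_orbitSeq, orbitSeq, Function.comp_apply,
      Function.iterate_zero, id_eq]
  have hpt' : ∀ q (z : ℕ → Y), (∀ j, z j ∉ range e) → F q z = fun _ => p pt := by
    intro q z hz
    funext j
    simp only [hF, itinerary, shift_iterate_apply]
    rw [hpt _ (hz _)]
  have hTm := hT.measurable
  have hpe : Measurable (p ∘ e) := hp.comp hme.measurable
  have hR1 : ∀ q w, (ν : Measure (ℕ → Y)).real (R ∩ F q ⁻¹' {w}) =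
      μ'.real (itinerary T (p ∘ e) q ⁻¹' {w}) := by
    intro q w
    rw [Measure.real, Measure.real,
      hμ'A _ (measurable_itinerary hTm hpe q (measurableSet_singleton w))]
    congr 1
    refine measure_congr ?_
    filter_upwards [hae] with z hz
    refine propext ?_
    change (z 0 ∈ range e ∧ F q z = w) ↔ ∃ x, itinerary T (p ∘ e) q x = w ∧ e x = z 0
    rcases hz with ⟨x, rfl⟩ | hz
    · rw [horb]
      refine ⟨fun h => ⟨x, h.2, rfl⟩, ?_⟩
      rintro ⟨x', hx', hxx⟩
      obtain rfl := he.injective (hxx : e x' = e x)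
      exact ⟨⟨x', rfl⟩, hx'⟩
    · exact iff_of_false (fun h => hz 0 h.1) fun ⟨x, _, hx⟩ => hz 0 ⟨x, hx⟩
  -- Off R almost every sequence is constantly `pt` and has a single itinerary, so this part adds
  -- one term at most 1 to the entropy, for every q.
  have hR2 : ∀ q w, (ν : Measure (ℕ → Y)).real (Rᶜ ∩ F q ⁻¹' {w}) =
      if w = fun _ => p pt then (ν : Measure (ℕ → Y)).real Rᶜ else 0 := by
    intro q w
    have hsplit : (Rᶜ ∩ F q ⁻¹' {w} : Set (ℕ → Y)) =ᵐ[(ν : Measure (ℕ → Y))]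
        (if w = fun _ => p pt then Rᶜ else ∅ : Set (ℕ → Y)) := by
      filter_upwards [hae] with z hz
      refine propext ?_
      change (z ∉ R ∧ F q z = w) ↔ z ∈ (if w = fun _ => p pt then Rᶜ else ∅ : Set (ℕ → Y))
      rcases hz with ⟨x, rfl⟩ | hz
      · have hxR : orbitSeq e T x ∈ R := ⟨x, rfl⟩
        split_ifs <;> simp [hxR]
      · have hzR : z ∉ R := hz 0
        rw [hpt' q z hz]
        split_ifs with hw
        · simp [hzR, hw]
        · simp [hzR, Ne.symm hw]
    rw [Measure.real, measure_congr hsplit]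
    split_ifs <;> simp [Measure.real]
  have hη : ∀ A, Real.negMulLog ((ν : Measure (ℕ → Y)).real A) ≤ 1 := fun A =>
    (Real.negMulLog_le_one_sub_self measureReal_nonneg).trans
      (by linarith [measureReal_nonneg (μ := (ν : Measure (ℕ → Y))) (s := A)])
  have hbound : ∀ q : ℕ, a * q ≤ fnEntropy μ' (itinerary T (p ∘ e) q) + 1 := by
    intro q
    refine (hle q).trans ?_
    have h1 : ∀ w, Real.negMulLog ((ν : Measure (ℕ → Y)).real (F q ⁻¹' {w})) ≤
        Real.negMulLog (μ'.real (itinerary T (p ∘ e) q ⁻¹' {w})) +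
          Real.negMulLog (if w = fun _ => p pt then (ν : Measure (ℕ → Y)).real Rᶜ else 0) := by
      intro w
      rw [← hR1, ← hR2, ← measureReal_inter_add_sdiff (s := F q ⁻¹' {w}) hRm,
        inter_comm _ R, Set.sdiff_eq, inter_comm _ Rᶜ]
      exact negMulLog_add_le measureReal_nonneg measureReal_nonneg
    refine (Finset.sum_le_sum fun w _ => h1 w).trans ?_
    rw [Finset.sum_add_distrib]
    refine add_le_add le_rfl ?_
    simp only [apply_ite Real.negMulLog, Real.negMulLog_zero, Finset.sum_ite_eq',
      Finset.mem_univ, if_true]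
    exact hη _
  set α : ℝ≥0∞ := μ' univ with hα
  have hα1 : α ≤ 1 := by rw [hμ'R]; exact prob_le_one
  have hαtop : α ≠ ⊤ := ne_top_of_le_ne_top ENNReal.one_ne_top hα1
  -- Without mass on orbits the entropy would be at most 1 for all q, against its linear growth.
  have hα0 : α ≠ 0 := by
    intro h
    have hz : μ' = 0 := Measure.measure_univ_eq_zero.1 h
    obtain ⟨q, hq⟩ := exists_nat_gt (1 / a)
    have := hbound q
    rw [hz] at this
    simp only [fnEntropy, measureReal_zero_apply, Real.negMulLog_zero, Finset.sum_const_zero,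
      zero_add] at this
    rw [div_lt_iff₀ ha] at hq
    linarith
  have hinv : μ'.map T = μ' := by
    ext A hA
    rw [Measure.map_apply hTm hA, hμ'A _ (hTm hA), hμ'A _ hA,
      ← hν.measure_preimage (s := {z | z 0 ∈ e '' A})
        (measurable_pi_apply 0 (hme.measurableSet_image' hA)).nullMeasurableSet]
    refine measure_congr ?_
    filter_upwards [hae] with z hz
    refine propext ?_
    change (∃ x, T x ∈ A ∧ e x = z 0) ↔ ∃ x, x ∈ A ∧ e x = z 1
    rcases hz with ⟨x, rfl⟩ | hz
    · constructor
      · rintro ⟨x', hx', hxx⟩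
        obtain rfl := he.injective (hxx : e x' = e x)
        exact ⟨_, hx', rfl⟩
      · rintro ⟨x', hx', hxx⟩
        obtain rfl := he.injective (hxx : e x' = e (T x))
        exact ⟨x, hx', rfl⟩
    · exact iff_of_false (fun ⟨x, _, hx⟩ => hz 0 ⟨x, hx⟩) fun ⟨x, _, hx⟩ => hz 1 ⟨x, hx⟩
  have hprob : IsProbabilityMeasure (α⁻¹ • μ') :=
    ⟨by rw [Measure.smul_apply, smul_eq_mul, ENNReal.inv_mul_cancel hα0 hαtop]⟩
  refine ⟨⟨α⁻¹ • μ', hprob⟩, ⟨hTm, ?_⟩, fun q => ?_⟩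
  · change (α⁻¹ • μ').map T = α⁻¹ • μ'
    rw [Measure.map_smul, hinv]
  · change a * q ≤ fnEntropy (α⁻¹ • μ') (itinerary T (p ∘ e) q) + 2
    have hmul : ∀ A, μ'.real A = α.toReal * (α⁻¹ • μ').real A := by
      intro A
      rw [Measure.real, Measure.real, Measure.smul_apply, smul_eq_mul, ← ENNReal.toReal_mul,
        ← mul_assoc, ENNReal.mul_inv_cancel hα0 hαtop, one_mul]
    -- Normalization changes the entropy by the factor α ≤ 1 and the term `negMulLog α` ≤ 1, the
    -- second unit of loss.
    have hsum : fnEntropy μ' (itinerary T (p ∘ e) q) = Real.negMulLog α.toReal +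
        α.toReal * fnEntropy (α⁻¹ • μ') (itinerary T (p ∘ e) q) := by
      simp only [fnEntropy, hmul, Real.negMulLog_mul, Finset.sum_add_distrib, ← Finset.sum_mul,
        ← Finset.mul_sum]
      rw [sum_measureReal_fiber _ (measurable_itinerary hTm hpe q), one_mul]
    have h1 := hbound q
    have h2 : Real.negMulLog α.toReal ≤ 1 :=
      (Real.negMulLog_le_one_sub_self ENNReal.toReal_nonneg).trans
        (by linarith [ENNReal.toReal_nonneg (a := α)])
    have h3 : α.toReal ≤ 1 := ENNReal.toReal_le_of_le_ofReal zero_le_one (by simpa using hα1)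
    have h4 := mul_le_mul_of_nonneg_right h3
      (fnEntropy_nonneg (α⁻¹ • μ') (itinerary T (p ∘ e) q))
    linarith

end Restrict

/-! ### Invariant measures of large entropy -/

theorem ofReal_le_kolmogorovSinaiEntropy {X ι : Type*} [MeasurableSpace X] [Fintype ι]
    [MeasurableSpace ι] [MeasurableSingletonClass ι] {T : X → X} {μ : ProbabilityMeasure X}
    {c : X → ι} (hc : Measurable c) {a b : ℝ}
    (h : ∀ q : ℕ, a * q ≤ fnEntropy (μ : Measure X) (itinerary T c q) + b) :
    ENNReal.ofReal a ≤ kolmogorovSinaiEntropy T μ := by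
  refine le_trans ?_ (le_iSup₂ (f := fun 𝒞 (_ : IsFinitePartition 𝒞) => entropyOfPartition T μ 𝒞)
    _ (isFinitePartition_range_fiber hc))
  have hlim : Tendsto (fun q : ℕ => ENNReal.ofReal (a - b / q)) atTop
      (𝓝 (ENNReal.ofReal (a - 0))) :=
    (ENNReal.continuous_ofReal.tendsto _).comp
      (tendsto_const_nhds.sub (tendsto_const_div_atTop_nhds_zero_nat b))
  rw [sub_zero] at hlim
  rw [← hlim.limsup_eq]
  refine limsup_le_limsup ?_
  filter_upwards [eventually_gt_atTop 0] with q hq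
  have hq' : (0 : ℝ) < q := by exact_mod_cast hq
  rw [partitionEntropy_iterCover_range_fiber, ← ENNReal.ofReal_natCast,
    ← ENNReal.ofReal_div_of_pos hq']
  refine ENNReal.ofReal_le_ofReal ?_
  rw [sub_le_iff_le_add, ← add_div, le_div_iff₀ hq']
  exact h q

/-- Codes of mesh below ε tell separated orbits apart, so their itineraries are injective on `E n`.
The coding is adapted to the marginal of the limit ν, hence chosen after it. -/
theorem exists_invariant_of_isOrbitSeparated {X Y : Type*} [TopologicalSpace X] [MeasurableSpace X]
    [BorelSpace X] [MetricSpace Y] [CompactSpace Y] {e : X → Y} (he : IsOpenEmbedding e) {pt : Y}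
    (hpt : ∀ y ∉ range e, y = pt) {T : X → X} (hT : Continuous T) {ε : ℝ} (hε : 0 < ε)
    {E : ℕ → Finset X} (hne : ∀ n, (E n).Nonempty) (hE : ∀ n, IsOrbitSeparated e T ε n (E n))
    {a : ℝ} (ha : 0 < a) (hfreq : ∃ᶠ n : ℕ in atTop, a * n ≤ Real.log (E n).card) :
    ∃ μ : ProbabilityMeasure X, MeasurePreserving T (μ : Measure X) μ ∧
      ENNReal.ofReal a ≤ kolmogorovSinaiEntropy T μ := by
  classical
  borelize Y
  have hinj : Function.Injective (orbitSeq e T) := fun x y h => he.injective (congrFun h 0)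
  obtain ⟨ν, hν, hG, hcode⟩ := exists_invariant_limit (continuous_shift (Y := Y))
    (fun n => (E n).image (orbitSeq e T)) (fun n => (hne n).image _) (a := a)
    (by simpa only [Finset.card_image_of_injective _ hinj] using hfreq)
  have h0 := hG _ (isOpen_setOf_not_orbit he hT) fun n z hz i => by
    obtain ⟨x, -, rfl⟩ := Finset.mem_image.1 hz
    rw [shift_iterate_orbitSeq]
    rintro ⟨x', hx', hne⟩
    obtain rfl := he.injective (hx' : e x' = e (T^[i] x))
    exact hne rfl
  have h0m : Measurable fun z : ℕ → Y => z 0 := measurable_pi_apply 0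
  have := Measure.isProbabilityMeasure_map (μ := (ν : Measure (ℕ → Y))) h0m.aemeasurable
  obtain ⟨N, p, hp, hpε, hploc⟩ := exists_fine_coding ((ν : Measure (ℕ → Y)).map fun z => z 0) hε
  have hq := hcode N (fun z => p (z 0)) (hp.comp h0m) ?_ ?_
  · obtain ⟨μ, hμ, hle⟩ := exists_invariant_of_shift_invariant he hpt hT hν h0 hp ha hq
    exact ⟨μ, hμ, ofReal_le_kolmogorovSinaiEntropy (hp.comp he.measurableEmbedding.measurable) hle⟩
  · filter_upwards [ae_of_ae_map h0m.aemeasurable hploc] with z hz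
    exact ((continuous_apply 0).tendsto z).eventually hz
  · rintro n z hz z' hz' h
    rw [Finset.mem_coe, Finset.mem_image] at hz hz'
    obtain ⟨x, hx, rfl⟩ := hz
    obtain ⟨y, hy, rfl⟩ := hz'
    rw [itinerary_eq_iff] at h
    refine congrArg _ (hE n x hx y hy fun j hj => hpε _ _ ?_)
    have hj := h j hj
    simp only [shift_iterate_orbitSeq] at hj
    exact hj

/-- The lower half of the variational principle. -/
theorem topologicalEntropy_le_supKolmogorovSinaiEntropy {X : Type*} [TopologicalSpace X]
    [TopologicalSpace.MetrizableSpace X] [LocallyCompactSpace X] [TopologicalSpace.SeparableSpace X]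
    [MeasurableSpace X] [BorelSpace X] {T : X → X} (hT : Continuous T) :
    topologicalEntropy T ≤ supKolmogorovSinaiEntropy T := by
  have := metrizableSpace_onePoint X
  let _ := TopologicalSpace.metrizableSpaceMetric (OnePoint X)
  have hreg : ∀ μ : ProbabilityMeasure X, (μ : Measure X).Regular := fun μ => by
    let _ := TopologicalSpace.metrizableSpaceMetric X
    have : SecondCountableTopology X := UniformSpace.secondCountable_of_separable X
    infer_instance
  refine iSup₂_le fun 𝒜 h𝒜 => le_of_forall_lt_imp_le_of_dense fun t ht => ?_
  rcases eq_or_ne t 0 with rfl | ht0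
  · exact zero_le
  set e : X → OnePoint X := (↑) with he
  -- An admissible cover extends to an open cover of the compactification, its member with compact
  -- complement giving a neighbourhood of ∞; ε is a Lebesgue number.
  have hleb : ∃ ε > 0, ∀ y : OnePoint X, ∃ A ∈ 𝒜, ∀ x : X, dist (e x) y < ε → x ∈ A := by
    obtain ⟨ε, hε, h⟩ := lebesgue_number_lemma_of_metric_sUnion
      (c := {V : Set (OnePoint X) | IsOpen V ∧ ∃ A ∈ 𝒜, e ⁻¹' V ⊆ A}) isCompact_univ
      (fun V hV => hV.1) fun y _ => by
        induction y using OnePoint.rec with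
        | infty =>
          obtain ⟨A, hA, hAc⟩ := h𝒜.exists_isCompact_compl
          refine ⟨(e '' Aᶜ)ᶜ, ⟨OnePoint.isOpen_compl_image_coe.2
            ⟨(h𝒜.isOpen A hA).isClosed_compl, hAc⟩, A, hA, fun x hx => ?_⟩, by simp [he]⟩
          exact by_contra fun hxA => hx ⟨x, hxA, rfl⟩
        | coe x =>
          have hx : x ∈ ⋃₀ 𝒜 := by rw [h𝒜.isCover]; trivial
          obtain ⟨A, hA, hxA⟩ := hx
          refine ⟨e '' A, ⟨OnePoint.isOpen_image_coe.2 (h𝒜.isOpen A hA), A, hA, ?_⟩, x, hxA, rfl⟩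
          rw [preimage_image_eq _ OnePoint.coe_injective]
    refine ⟨ε, hε, fun y => ?_⟩
    obtain ⟨V, ⟨-, A, hA, hVA⟩, hyV⟩ := h y (mem_univ y)
    exact ⟨A, hA, fun x hx => hVA (hyV hx)⟩
  obtain ⟨ε, hε, h𝒜ε⟩ := hleb
  choose E hE hEmax using fun n => exists_maximal_isOrbitSeparated e T hε n
  have hcov := fun n => coverEntropy_iterCover_le (fun x => h𝒜ε (e x)) hε (hEmax n)
  have htop : t ≠ ⊤ := ht.ne_top
  have hfreq : ∃ᶠ n : ℕ in atTop, 0 < n ∧ t.toReal * n ≤ Real.log (E n).card := by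
    refine ((frequently_lt_of_lt_limsup (by isBoundedDefault) ht).and_eventually
      (eventually_gt_atTop 0)).mono fun n hn => ⟨hn.2, ?_⟩
    have hn' : (0 : ℝ) < n := by exact_mod_cast hn.2
    have h1 := hn.1.le.trans (ENNReal.div_le_div_right (hcov n) _)
    rw [← ENNReal.ofReal_natCast n, ← ENNReal.ofReal_div_of_pos hn'] at h1
    have h2 := ENNReal.toReal_le_of_le_ofReal
      (div_nonneg (Real.log_natCast_nonneg _) hn'.le) h1
    rwa [le_div_iff₀ hn'] at h2
  have hpos := ENNReal.toReal_pos ht0 htop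
  -- For empty X all `E n` would be empty and `log 0 = 0` would contradict the positive growth.
  have hX : Nonempty X := by
    obtain ⟨n, hn, hle⟩ := hfreq.exists
    have h1 : 0 < Real.log (E n).card := lt_of_lt_of_le (by positivity) hle
    have h2 : (E n).Nonempty := Finset.nonempty_iff_ne_empty.2 fun h => by simp [h] at h1
    exact ⟨h2.choose⟩
  have hne : ∀ n, (E n).Nonempty := fun n => by
    obtain ⟨y, hy, -⟩ := hEmax n (Classical.arbitrary X)
    exact ⟨y, hy⟩
  have hpt : ∀ y ∉ range e, y = OnePoint.infty := fun y hy => by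
    exact by_contra fun hne => hy (OnePoint.ne_infty_iff_exists.1 hne)
  obtain ⟨μ, hμ, hle⟩ := exists_invariant_of_isOrbitSeparated OnePoint.isOpenEmbedding_coe hpt hT hε
    hne hE hpos (hfreq.mono fun n hn => hn.2)
  rw [ENNReal.ofReal_toReal htop] at hle
  exact hle.trans (le_iSup_of_le μ (le_iSup₂_of_le (hreg μ) hμ le_rfl))

end VarPrinciple

/-! ### The main theorem -/

theorem mainTheorem1 {X : Type*} [TopologicalSpace X] [TopologicalSpace.MetrizableSpace X]
    [LocallyCompactSpace X] [TopologicalSpace.SeparableSpace X]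
    [MeasurableSpace X] [BorelSpace X] (T : X → X) (hT : Continuous T) :
    VarPrinciple.supKolmogorovSinaiEntropy T = VarPrinciple.topologicalEntropy T ∧
    IsLeast {h : ℝ≥0∞ | ∃ d : X → X → ℝ, VarPrinciple.IsCompatibleMetric d ∧
        h = VarPrinciple.bowenEntropy d T} (VarPrinciple.topologicalEntropy T) ∧
    IsLeast {h : ℝ≥0∞ | ∃ d : X → X → ℝ, VarPrinciple.IsCompatibleMetric d ∧
        h = VarPrinciple.dEntropy d T} (VarPrinciple.topologicalEntropy T) ∧
    (∃ d : X → X → ℝ, VarPrinciple.IsCompatibleMetric d ∧ VarPrinciple.ExtendsToOnePoint d) ∧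
    (∀ d : X → X → ℝ, VarPrinciple.IsCompatibleMetric d → VarPrinciple.ExtendsToOnePoint d →
      VarPrinciple.bowenEntropy d T = VarPrinciple.topologicalEntropy T ∧
      VarPrinciple.dEntropy d T = VarPrinciple.topologicalEntropy T) := by
  have hlow := VarPrinciple.topologicalEntropy_le_supKolmogorovSinaiEntropy hT
  have hbow : ∀ d : X → X → ℝ, VarPrinciple.IsCompatibleMetric d →
      VarPrinciple.topologicalEntropy T ≤ VarPrinciple.bowenEntropy d T := fun d hd =>
    hlow.trans (hd.supKolmogorovSinaiEntropy_le T)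
  have hext : ∀ d : X → X → ℝ, VarPrinciple.IsCompatibleMetric d →
      VarPrinciple.ExtendsToOnePoint d →
      VarPrinciple.bowenEntropy d T = VarPrinciple.topologicalEntropy T ∧
      VarPrinciple.dEntropy d T = VarPrinciple.topologicalEntropy T := fun d hd hd' => by
    have h1 := VarPrinciple.bowenEntropy_le_dEntropy d T
    have h2 := VarPrinciple.dEntropy_le_topologicalEntropy hd' T
    exact ⟨le_antisymm (h1.trans h2) (hbow d hd), le_antisymm h2 ((hbow d hd).trans h1)⟩
  obtain ⟨d, hd, hd'⟩ : ∃ d : X → X → ℝ, VarPrinciple.IsCompatibleMetric d ∧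
      VarPrinciple.ExtendsToOnePoint d := by
    have := VarPrinciple.metrizableSpace_onePoint X
    let _ := TopologicalSpace.metrizableSpaceMetric (OnePoint X)
    exact ⟨_, VarPrinciple.isCompatibleMetric_dist_comp OnePoint.isOpenEmbedding_coe.isEmbedding,
      dist, VarPrinciple.isCompatibleMetric_dist_comp IsEmbedding.id, fun _ _ => rfl⟩
  -- A single extending metric bounds sup h_μ by h(T) and attains both minima.
  refine ⟨le_antisymm ((hd.supKolmogorovSinaiEntropy_le T).trans (hext d hd hd').1.le) hlow,
    ⟨⟨d, hd, (hext d hd hd').1.symm⟩, ?_⟩, ⟨⟨d, hd, (hext d hd hd').2.symm⟩, ?_⟩,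
    ⟨d, hd, hd'⟩, hext⟩
  · rintro _ ⟨d, hd, rfl⟩
    exact hbow d hd
  · rintro _ ⟨d, hd, rfl⟩
    exact (hbow d hd).trans (VarPrinciple.bowenEntropy_le_dEntropy d T)
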